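/- Let $p\ge 0$ and $q\ge 1$ be integers, and let $\mathbb R_{p+q}$ be the real Clifford algebra generated by $e_1,\dots,e_{p+q}$ with $e_ie_j+e_je_i=-2\delta_{ij}$; put $e_0=1$. Write points of $\mathbb R^{p+q+1}$ as $x=x_p+\underline{x}_q$ with $x_p=\sum_{i=0}^{p}x_ie_i\in\mathbb R^{p+1}$ and $\underline{x}_q=\sum_{i=p+1}^{p+q}x_ie_i\in\mathbb R^{q}$, and put $r=|\underline{x}_q|$, $x_\diamond=x_p-\underline{x}_q$. Let $\mathbb S$ be the unit sphere of $\mathbb R^q$, $\Delta=\sum_{i=0}^{p+q}\partial_{x_i}^2$, $D_{x_p}=\sum_{i=0}^{p}e_i\partial_{x_i}$ and $\overline D_{x_p}=\partial_{x_0}-\sum_{i=1}^{p}e_i\partial_{x_i}$. Let $D\subseteq\mathbb R^{p+2}=\mathbb R^{p+1}\times\mathbb R$ be an open set (in particular, any domain) with $(x_p,r)\in D\Rightarrow(x_p,-r)\in D$, and let $\Omega_D=\{x_p+r\underline\omega:\ \underline\omega\in\mathbb S,\ r\ge 0,\ (x_p,r)\in D\}$. Let $f:\Omega_D\to\mathbb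 R_{p+q}$ be generalized partial-slice regular, that is, there are $C^1$ functions $F_1,F_2:D\to\mathbb R_{p+q}$, with $F_1$ even and $F_2$ odd in the last variable, such that $f(x_p+r\underline\omega)=F_1(x_p,r)+\underline\omega F_2(x_p,r)$ for $\underline\omega\in\mathbb S$, $r\ge0$, $(x_p,r)\in D$, and $$D_{x_p}F_1-\partial_rF_2=0,\qquad \overline D_{x_p}F_2+\partial_rF_1=0\qquad\text{on }D.$$ Let $f^\circ_s(x)=\frac12\big(f(x)+f(x_\diamond)\big)$ for $x\in\Omega_D$, let $f'_s(x)=\frac12\underline{x}_q^{-1}\big(f(x)-f(x_\diamond)\big)$ for $x\in\Omega_D\setminus\mathbb R^{p+1}$, and extend $f'_s$ to $\Omega_D\cap\mathbb R^{p+1}$ by continuity. Then there are functions $G_1,G_2$ that are real analytic at every point of $\{(x_p,r^2):(x_p,r)\in D\}$ and satisfy $f^\circ_s(x)=G_1(x_p,r^2)$ and $f'_s(x)=G_2(x_p,r^2)$ for all $x\in\Omega_D$. For every such pair, with $\partial_{p+2}$ denoting the partial derivative in the last variable, the following hold. (i) For $k=1,\dots,\left[\frac{q-1}2\right]$ and $x\in\Omega_D$,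 $$\Delta^kf'_s(x)=2^k(q-3)(q-5)\cdots(q-2k-1)\,\partial_{p+2}^kG_2(x_p,r^2).$$ (ii) For $k=1,\dots,\left[\frac{q+1}2\right]$ and $x\in\Omega_D$, $$\Delta^kf^\circ_s(x)=2^k(q-1)(q-3)\cdots(q-2k+1)\,\partial_{p+2}^kG_1(x_p,r^2).$$ Moreover: (iii) For $x\in\Omega_D\setminus\mathbb R^{p+1}$, $$\Delta f'_s(x)=\frac{q-3}{r^2}\big(D_{x_p}f^\circ_s(x)-f'_s(x)\big).$$ (iv) For $x\in\Omega_D$, $\ \Delta f^\circ_s(x)=(1-q)\,\overline D_{x_p}f'_s(x)$. (v) If $q$ is odd, then $\Delta^{(q+1)/2}f^\circ_s(x)=0$ for all $x\in\Omega_D$. -/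

import Mathlib

open Topology

noncomputable section

namespace PartialSlice

/-! ### The Clifford algebra `ℝ_{p+q}` -/

/-- The negative definite quadratic form `v ↦ -∑ vᵢ²` on `ℝⁿ`. -/
def negForm (n : ℕ) : QuadraticForm ℝ (Fin n → ℝ) :=
  QuadraticMap.weightedSumSquares ℝ (fun _ : Fin n => (-1 : ℝ))

/-- The real Clifford algebra generated by `e₁, …, eₙ` with `eᵢ eⱼ + eⱼ eᵢ = -2 δᵢⱼ`. -/
abbrev Cl (n : ℕ) : Type := CliffordAlgebra (negForm n)

/-- The generators; the generator written `e_{i+1}` in one-based numbering is `e i`. -/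
def e {n : ℕ} (i : Fin n) : Cl n := CliffordAlgebra.ι (negForm n) (Pi.single i 1)

theorem e_mul_e_add {n : ℕ} (i j : Fin n) :
    (e i * e j + e j * e i : Cl n) = algebraMap ℝ (Cl n) (if i = j then -2 else 0) := by
  unfold e
  rw [CliffordAlgebra.ι_mul_ι_add_swap]
  congr 1
  simp only [QuadraticMap.polar, negForm, QuadraticMap.weightedSumSquares_apply, Pi.add_apply,
    smul_eq_mul, ← Finset.sum_sub_distrib]
  split_ifs with h
  · subst h
    rw [Finset.sum_eq_single i]
    · norm_num
    · intro b _ hb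
      simp [hb]
    · simp
  · apply Finset.sum_eq_zero
    intro k _
    by_cases hk : k = i
    · subst hk
      simp [h]
    · simp [hk]

/-- The real basis of the Clifford algebra indexed by the subsets `A` of the set of generators:
the image of the standard basis of the exterior algebra under the canonical linear isomorphism
(for orthogonal generators, a wedge product of distinct generators corresponds to their
Clifford product `e_A`). -/
def clBasis (n : ℕ) : Module.Basis (Finset (Fin n)) ℝ (Cl n) :=
  (Module.Basis.ExteriorAlgebra (Pi.basisFun ℝ (Fin n))).map
    (CliffordAlgebra.equivExterior (negForm n)).symm

/-- Coordinates with respect to `clBasis`, as an element of a Euclidean space. -/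
def clCoord (n : ℕ) : Cl n →ₗ[ℝ] EuclideanSpace ℝ (Finset (Fin n)) :=
  ((clBasis n).equivFun.trans (WithLp.linearEquiv 2 ℝ (Finset (Fin n) → ℝ)).symm).toLinearMap

theorem clCoord_injective (n : ℕ) : Function.Injective (clCoord n) :=
  ((clBasis n).equivFun.trans (WithLp.linearEquiv 2 ℝ (Finset (Fin n) → ℝ)).symm).injective

/-- The norm `|a| = (∑_A |a_A|²)^{1/2}`. -/
instance instNormedAddCommGroupCl (n : ℕ) : NormedAddCommGroup (Cl n) :=
  NormedAddCommGroup.induced (Cl n) (EuclideanSpace ℝ (Finset (Fin n))) (clCoord n)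
    (clCoord_injective n)

instance instNormedSpaceCl (n : ℕ) : NormedSpace ℝ (Cl n) :=
  NormedSpace.induced ℝ (Cl n) (EuclideanSpace ℝ (Finset (Fin n))) (clCoord n)

/-! ### Variables -/

/-- `ℝ^{p+q+1}`, with the coordinates `x₀, …, x_p` and `x_{p+1}, …, x_{p+q}` separated. -/
abbrev Space (p q : ℕ) : Type := EuclideanSpace ℝ (Fin (p + 1) ⊕ Fin q)

/-- `ℝ^{p+2}`, the space of the variables `(x_p, r)`. -/
abbrev HalfSpace (p : ℕ) : Type := EuclideanSpace ℝ (Fin (p + 1)) × ℝ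

variable {p q : ℕ}

/-- The component `x_p = (x₀, …, x_p)`. -/
def xp (x : Space p q) : EuclideanSpace ℝ (Fin (p + 1)) := WithLp.toLp 2 fun i => x (Sum.inl i)

/-- The component `(x_{p+1}, …, x_{p+q})`. -/
def xq (x : Space p q) : EuclideanSpace ℝ (Fin q) := WithLp.toLp 2 fun j => x (Sum.inr j)

/-- The point `y + v` of `ℝ^{p+q+1} = ℝ^{p+1} ⊕ ℝ^q`. -/
def joinPt (y : EuclideanSpace ℝ (Fin (p + 1))) (v : EuclideanSpace ℝ (Fin q)) : Space p q :=
  WithLp.toLp 2 (Sum.elim (fun i => y i) (fun j => v j))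

/-- The point `x_⋄ = x_p - x_q`. -/
def reflPt (x : Space p q) : Space p q := joinPt (xp x) (-xq x)

/-- A vector of `ℝ^q` as the element `∑ v_j e_{p+j}` of the Clifford algebra. -/
def vec (p : ℕ) {q : ℕ} (v : EuclideanSpace ℝ (Fin q)) : Cl (p + q) :=
  ∑ j, v j • e (Fin.natAdd p j)

/-- The units `e₀ = 1, e₁, …, e_p`. -/
def unit (p q : ℕ) : Fin (p + 1) → Cl (p + q) :=
  Fin.cases 1 fun i => e (Fin.castAdd q i)

/-- The Clifford conjugates `1, -e₁, …, -e_p` of the units `e₀, …, e_p`. -/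
def unitConj (p q : ℕ) : Fin (p + 1) → Cl (p + q) :=
  Fin.cases 1 fun i => -e (Fin.castAdd q i)

/-! ### Differential operators -/

/-- `D_{x_p} g = ∑_{i=0}^p e_i ∂_{x_i} g` for functions of `x`. -/
def dirac (g : Space p q → Cl (p + q)) (x : Space p q) : Cl (p + q) :=
  ∑ i, unit p q i * fderiv ℝ g x (EuclideanSpace.single (Sum.inl i) 1)

/-- The conjugate operator `∂_{x₀} g - ∑_{i=1}^p e_i ∂_{x_i} g` for functions of `x`. -/
def diracConj (g : Space p q → Cl (p + q)) (x : Space p q) : Cl (p + q) :=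
  ∑ i, unitConj p q i * fderiv ℝ g x (EuclideanSpace.single (Sum.inl i) 1)

/-- `D_{x_p} F` for functions of `(x_p, r)`. -/
def diracHalf (F : HalfSpace p → Cl (p + q)) (z : HalfSpace p) : Cl (p + q) :=
  ∑ i, unit p q i * fderiv ℝ F z (EuclideanSpace.single i 1, 0)

/-- The conjugate of `D_{x_p}` for functions of `(x_p, r)`. -/
def diracConjHalf (F : HalfSpace p → Cl (p + q)) (z : HalfSpace p) : Cl (p + q) :=
  ∑ i, unitConj p q i * fderiv ℝ F z (EuclideanSpace.single i 1, 0)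

/-- `∂_r F` for functions of `(x_p, r)`. -/
def derivR (F : HalfSpace p → Cl (p + q)) (z : HalfSpace p) : Cl (p + q) :=
  fderiv ℝ F z (0, 1)

/-- The Laplacian `∑_{i=0}^{p+q} ∂_{x_i}²` in `ℝ^{p+q+1}`. -/
def lap (g : Space p q → Cl (p + q)) : Space p q → Cl (p + q) :=
  Laplacian.laplacian g

/-! ### Generalized partial-slice regular functions -/

/-- The partially symmetric completion `Ω_D = {y + r ω : |ω| = 1, r ≥ 0, (y, r) ∈ D}`. -/
def Omega (q : ℕ) (D : Set (HalfSpace p)) : Set (Space p q) :=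
  {x | ∃ (y : EuclideanSpace ℝ (Fin (p + 1))) (r : ℝ) (ω : EuclideanSpace ℝ (Fin q)),
    ‖ω‖ = 1 ∧ 0 ≤ r ∧ (y, r) ∈ D ∧ x = joinPt y (r • ω)}

/-- `f = I(F₁, F₂)` on `Ω_D`: `F₁` is even and `F₂` is odd in `r`, and
`f(y + r ω) = F₁(y, r) + ω F₂(y, r)`. -/
structure IsInducedBy (D : Set (HalfSpace p)) (f : Space p q → Cl (p + q))
    (F₁ F₂ : HalfSpace p → Cl (p + q)) : Prop where
  even : ∀ y r, (y, r) ∈ D → F₁ (y, -r) = F₁ (y, r)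
  odd : ∀ y r, (y, r) ∈ D → F₂ (y, -r) = -F₂ (y, r)
  eq : ∀ y r (ω : EuclideanSpace ℝ (Fin q)), ‖ω‖ = 1 → 0 ≤ r → (y, r) ∈ D →
    f (joinPt y (r • ω)) = F₁ (y, r) + vec p ω * F₂ (y, r)

/-- `f` is generalized partial-slice regular of type `(p, q)` on `Ω_D`: it is induced by a pair of
`C¹` functions on `D` that satisfy the generalized Cauchy-Riemann equations. (`f` is a total
function, of which only the values on `Ω_D` matter.) -/
def IsRegular (D : Set (HalfSpace p)) (f : Space p q → Cl (p + q)) : Prop :=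
  ∃ F₁ F₂ : HalfSpace p → Cl (p + q),
    IsInducedBy D f F₁ F₂ ∧ ContDiffOn ℝ 1 F₁ D ∧ ContDiffOn ℝ 1 F₂ D ∧
    ∀ z ∈ D, diracHalf F₁ z - derivR F₂ z = 0 ∧ diracConjHalf F₂ z + derivR F₁ z = 0

/-- The spherical value `½ (f(x) + f(x_⋄))`. -/
def sphValue (f : Space p q → Cl (p + q)) (x : Space p q) : Cl (p + q) :=
  (1 / 2 : ℝ) • (f x + f (reflPt x))

/-- The expression `½ x_q⁻¹ (f(x) - f(x_⋄))`, meaningful for `x_q ≠ 0`. -/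
def sphDerivAux (f : Space p q → Cl (p + q)) (x : Space p q) : Cl (p + q) :=
  (1 / 2 : ℝ) • (Ring.inverse (vec p (xq x)) * (f x - f (reflPt x)))

open Classical in
/-- The spherical derivative: `½ x_q⁻¹ (f(x) - f(x_⋄))` off `ℝ^{p+1}`, extended to the points of
`ℝ^{p+1}` as the limit of these values. -/
def sphDeriv (f : Space p q → Cl (p + q)) (x : Space p q) : Cl (p + q) :=
  if xq x = 0 then Filter.limUnder (𝓝[{y | xq y ≠ 0}] x) (sphDerivAux f) else sphDerivAux f x

/-- The pair `(G₁, G₂)` is real analytic, namely at every point `(y, r²)` with `(y, r) ∈ D`, and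
represents the spherical value and derivative of `f` on `Ω_D` as `G₁(x_p, r²)` and
`G₂(x_p, r²)`, where `r = |x_q|`. -/
structure IsRepresentedBy (D : Set (HalfSpace p)) (f : Space p q → Cl (p + q))
    (G₁ G₂ : HalfSpace p → Cl (p + q)) : Prop where
  analytic₁ : AnalyticOnNhd ℝ G₁ ((fun z : HalfSpace p => (z.1, z.2 ^ 2)) '' D)
  analytic₂ : AnalyticOnNhd ℝ G₂ ((fun z : HalfSpace p => (z.1, z.2 ^ 2)) '' D)
  value : ∀ x ∈ Omega q D, sphValue f x = G₁ (xp x, ‖xq x‖ ^ 2)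
  deriv : ∀ x ∈ Omega q D, sphDeriv f x = G₂ (xp x, ‖xq x‖ ^ 2)

/-- `∂_{p+2}^k G`, the `k`-th partial derivative of `G` in its last variable. -/
def partialLast (k : ℕ) (G : HalfSpace p → Cl (p + q)) (z : HalfSpace p) : Cl (p + q) :=
  iteratedDeriv k (fun s : ℝ => G (z.1, s)) z.2

end PartialSlice

end

/-! Off `ℝ^{p+1}` the spherical value is `F₁(x_p, r)` and the spherical derivative is `r⁻¹ F₂(x_p,
r)`. The theorem has two halves: these are analytic functions of `(x_p, s)` with `s = r²`, and their
Laplacians follow from a second-order equation in `(x_p, s)`.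

Analyticity. A `C¹` solution of the Cauchy-Riemann system is harmonic in the sense of distributions,
since the units satisfy Clifford relations (`weaklyHarmonicOn_of_cauchyRiemann`). Adding `p + 2`
variables on which it does not depend makes the dimension `n = 2k + 2` with `k = p + 1`, so that the
Newtonian kernel `|x - y|^{2-n}` is the `k`-th power of `|x - y|⁻²`. With a cut-off, the function is
then given near a point by continuous linear functionals on `C(S)`, for a compact shell `S`, applied
to powers of the inverse of `|x - ·|²` times polynomials (`WeaklyHarmonicOn.exists_representation`).
Inversion in the Banach algebra `C(S)` is analytic, hence so is the function. The same formula
separates even and odd powers of `r`: functions `g(y, r²) + r h(y, r²)` with analytic `g`, `h` are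
stable under products and inverses (`HasParitySplit.inverse`). Evenness of `F₁` kills `h`, oddness
of `F₂` kills `g`. The local functions of `(y, s)` are glued by continuation along vertical segments
(`exists_analytic_extension`).

Laplacians. Substituting `F₁ = G₁(y, r²)` and `F₂ = r G₂(y, r²)` turns the system into `D G₁ = G₂ +
2s ∂ₛG₂` and `D̄ G₂ = -2 ∂ₛG₁`. Eliminating one function gives `∑ ∂ᵢ²G + 4s ∂ₛ²G + c ∂ₛG = 0` with
`c = 2` for `G₁` and `c = 6` for `G₂`; each `∂ₛ` raises `c` by `4`. In `ℝ^{p+q+1}` the Laplacian of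
`G(x_p, |x_q|²)` is the same expression with `c` replaced by `2q`, so it equals `(2q - c) ∂ₛG`, and
iteration gives the products (`iterate_lap_eq`). The remaining identities combine the case `k = 1`
with the first-order system, or exhibit a zero factor. -/

noncomputable section

namespace PartialSlice

open MeasureTheory Filter Metric Set

/-! ### The regularized Newtonian kernel in even dimension -/

section Weyl

variable {ι : Type*} [Fintype ι] {W : Type*} [NormedAddCommGroup W] [NormedSpace ℝ W]

/-- The regularized kernel `(|x - y|² + t)⁻¹`. -/
def reg (x : EuclideanSpace ℝ ι) (t : ℝ) (y : EuclideanSpace ℝ ι) : ℝ := (‖x - y‖ ^ 2 + t)⁻¹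

theorem hasFDerivAt_reg (x y : EuclideanSpace ℝ ι) {t : ℝ} (ht : 0 < t) :
    HasFDerivAt (reg x t) ((2 * reg x t y ^ 2) • innerSL ℝ (x - y)) y := by
  have h0 : ‖x - y‖ ^ 2 + t ≠ 0 := by positivity
  have h1 : HasFDerivAt (fun y => ‖x - y‖ ^ 2 + t) _ y :=
    (((hasFDerivAt_id y).const_sub x).norm_sq).add_const t
  refine (((hasDerivAt_inv h0).comp_hasFDerivAt y h1)).congr_fderiv ?_
  ext v
  simp [reg]
  ring

theorem contDiff_reg (x : EuclideanSpace ℝ ι) {t : ℝ} (ht : 0 < t) {n : WithTop ℕ∞} :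
    ContDiff ℝ n (reg x t) := by
  have : ContDiff ℝ n fun y : EuclideanSpace ℝ ι => ‖x - y‖ ^ 2 + t :=
    ((contDiff_const.sub contDiff_id).norm_sq ℝ).add contDiff_const
  exact this.inv fun y => by positivity

variable [DecidableEq ι]

/-- The `i`-th partial derivative of a real function on a Euclidean space. -/
def pd (i : ι) (φ : EuclideanSpace ℝ ι → ℝ) (x : EuclideanSpace ℝ ι) : ℝ :=
  fderiv ℝ φ x (EuclideanSpace.single i 1)

/-- Continuity and harmonicity on `U` in the sense of distributions. -/
structure WeaklyHarmonicOn (u : EuclideanSpace ℝ ι → W) (U : Set (EuclideanSpace ℝ ι)) : Prop where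
  cont : ContinuousOn u U
  integral_eq_zero : ∀ φ : EuclideanSpace ℝ ι → ℝ, ContDiff ℝ 2 φ → HasCompactSupport φ →
    tsupport φ ⊆ U → ∫ x, (∑ i, pd i (pd i φ) x) • u x = 0

theorem contDiff_pd {n m : WithTop ℕ∞} {φ : EuclideanSpace ℝ ι → ℝ} (hφ : ContDiff ℝ n φ)
    (h : m + 1 ≤ n) (i : ι) : ContDiff ℝ m (pd i φ) :=
  (hφ.fderiv_right h).clm_apply contDiff_const

theorem pd_mul {φ ψ : EuclideanSpace ℝ ι → ℝ} {x : EuclideanSpace ℝ ι}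
    (hφ : DifferentiableAt ℝ φ x) (hψ : DifferentiableAt ℝ ψ x) (i : ι) :
    pd i (fun y => φ y * ψ y) x = φ x * pd i ψ x + ψ x * pd i φ x := by
  simp [pd, fderiv_fun_mul hφ hψ]

theorem pd_add {φ ψ : EuclideanSpace ℝ ι → ℝ} {x : EuclideanSpace ℝ ι}
    (hφ : DifferentiableAt ℝ φ x) (hψ : DifferentiableAt ℝ ψ x) (i : ι) :
    pd i (fun y => φ y + ψ y) x = pd i φ x + pd i ψ x := by
  simp [pd, fderiv_fun_add hφ hψ]

theorem pd_pd_mul {φ ψ : EuclideanSpace ℝ ι → ℝ} (hφ : ContDiff ℝ 2 φ) (hψ : ContDiff ℝ 2 ψ)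
    (x : EuclideanSpace ℝ ι) (i : ι) :
    pd i (pd i fun y => φ y * ψ y) x =
      φ x * pd i (pd i ψ) x + 2 * (pd i φ x * pd i ψ x) + ψ x * pd i (pd i φ) x := by
  have h1 := contDiff_pd hφ (m := 1) (by norm_num) i
  have h2 := contDiff_pd hψ (m := 1) (by norm_num) i
  have d := fun (f : EuclideanSpace ℝ ι → ℝ) (hf : ContDiff ℝ 1 f) => hf.differentiable (by norm_num)
  have e1 := d _ (hφ.of_le (by norm_num))
  have e2 := d _ (hψ.of_le (by norm_num))
  have : (pd i fun y => φ y * ψ y) = fun y => φ y * pd i ψ y + ψ y * pd i φ y := by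
    ext y; exact pd_mul (e1 y) (e2 y) i
  rw [this, pd_add ((e1 x).fun_mul (d _ h2 x)) ((e2 x).fun_mul (d _ h1 x)), pd_mul (e1 x) (d _ h2 x),
    pd_mul (e2 x) (d _ h1 x)]
  ring

theorem pd_reg_pow (x : EuclideanSpace ℝ ι) {t : ℝ} (ht : 0 < t) (k : ℕ) (i : ι) :
    pd i (fun y => reg x t y ^ k) = fun y => (2 * k * (x i - y i)) * reg x t y ^ (k + 1) := by
  ext y
  have := (hasFDerivAt_reg x y ht).pow k
  rw [pd, this.fderiv]
  rcases k with _ | k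
  · simp
  · simp [EuclideanSpace.inner_single_right]
    ring

theorem pd_pd_reg_pow (x : EuclideanSpace ℝ ι) {t : ℝ} (ht : 0 < t) (k : ℕ) (i : ι)
    (y : EuclideanSpace ℝ ι) :
    pd i (pd i (fun y => reg x t y ^ k)) y = -(2 * k) * reg x t y ^ (k + 1) +
      4 * k * (k + 1) * (x i - y i) ^ 2 * reg x t y ^ (k + 2) := by
  have hl : HasFDerivAt (fun y : EuclideanSpace ℝ ι => 2 * k * (x i - y i))
      ((2 * k : ℝ) • -(EuclideanSpace.proj i : EuclideanSpace ℝ ι →L[ℝ] ℝ)) y :=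
    (((EuclideanSpace.proj i : EuclideanSpace ℝ ι →L[ℝ] ℝ).hasFDerivAt).const_sub (x i)).const_mul _
  rw [pd_reg_pow x ht, pd_mul hl.differentiableAt
    (((contDiff_reg x ht (n := 1)).pow _).differentiable (by norm_num) y), pd_reg_pow x ht, pd,
    hl.fderiv]
  simp
  ring

/-- In dimension `2k + 2` the power `|x - y|^{-2k}` is harmonic off `x`, so only a term with the
factor `t` survives. Up to a constant that term is an approximate identity as `t → 0`. -/
theorem laplacian_reg_pow (x : EuclideanSpace ℝ ι) {t : ℝ} (ht : 0 < t) {k : ℕ}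
    (hk : Fintype.card ι = 2 * k + 2) (y : EuclideanSpace ℝ ι) :
    ∑ i, pd i (pd i (fun y => reg x t y ^ k)) y =
      -(4 * k * (k + 1) * t) * reg x t y ^ (k + 2) := by
  have h0 : reg x t y * (‖x - y‖ ^ 2 + t) = 1 := inv_mul_cancel₀ (by positivity)
  simp_rw [pd_pd_reg_pow x ht]
  rw [Finset.sum_add_distrib, ← Finset.sum_mul, ← Finset.sum_mul, ← Finset.mul_sum]
  have hs : ∑ i, (x i - y i) ^ 2 = ‖x - y‖ ^ 2 := by
    rw [EuclideanSpace.norm_sq_eq]; simp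
  rw [hs, Finset.sum_const, Finset.card_univ, hk]
  have e1 : ‖x - y‖ ^ 2 * reg x t y ^ (k + 2) = reg x t y ^ (k + 1) - t * reg x t y ^ (k + 2) := by
    linear_combination reg x t y ^ (k + 1) * h0
  push_cast [nsmul_eq_mul]
  linear_combination (4 * k * (k + 1) : ℝ) * e1

end Weyl

/-! ### The approximate identity and the cut-off Green formula -/

section Weyl
variable {ι : Type*} [Fintype ι] {W : Type*} [NormedAddCommGroup W] [NormedSpace ℝ W]

/-- The total mass of the kernel `y ↦ (|y|² + 1)^{-(k+2)}`. -/
def regMass (ι : Type*) [Fintype ι] (k : ℕ) : ℝ :=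
  ∫ y : EuclideanSpace ℝ ι, (1 + ‖y‖ ^ 2)⁻¹ ^ (k + 2)

theorem integrable_inv_one_add_norm_sq_pow {k : ℕ} (hk : Fintype.card ι = 2 * k + 2) :
    Integrable fun y : EuclideanSpace ℝ ι => (1 + ‖y‖ ^ 2)⁻¹ ^ (k + 2) := by
  have h := integrable_rpow_neg_one_add_norm_sq (E := EuclideanSpace ℝ ι) (μ := volume)
    (r := 2 * (k + 2)) (by rw [finrank_euclideanSpace, hk]; push_cast; linarith)
  refine h.congr (Eventually.of_forall fun y => ?_)
  have h0 : (0 : ℝ) ≤ 1 + ‖y‖ ^ 2 := by positivity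
  have : (-(2 * ((k : ℝ) + 2)) / 2) = -((k + 2 : ℕ) : ℝ) := by push_cast; ring
  simp only [this]
  rw [Real.rpow_neg h0, Real.rpow_natCast, inv_pow]

theorem regMass_pos {k : ℕ} (hk : Fintype.card ι = 2 * k + 2) : 0 < regMass ι k := by
  have hpos : ∀ y : EuclideanSpace ℝ ι, 0 < (1 + ‖y‖ ^ 2)⁻¹ ^ (k + 2) := fun y => by positivity
  rw [regMass, integral_pos_iff_support_of_nonneg (fun y => (hpos y).le)
    (integrable_inv_one_add_norm_sq_pow hk)]
  have : Function.support (fun y : EuclideanSpace ℝ ι => (1 + ‖y‖ ^ 2)⁻¹ ^ (k + 2)) = univ := by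
    ext y; simpa using (hpos y).ne'
  rw [this]
  exact isOpen_univ.measure_pos _ univ_nonempty

/-- With `t = c⁻²`, the kernel `t (|x - y|² + t)^{-(k+2)}` is `cⁿ φ(c(x - y))` for `φ(y) = (1 +
|y|²)^{-(k+2)}` and `n = 2k + 2`. Its mass is therefore `regMass ι k` for every `c`. -/
theorem tendsto_integral_reg [CompleteSpace W] {k : ℕ} (hk : Fintype.card ι = 2 * k + 2)
    {g : EuclideanSpace ℝ ι → W}
    (hg : Integrable g) {x : EuclideanSpace ℝ ι} (hx : ContinuousAt g x) :
    Tendsto (fun c : ℝ => ∫ y, ((c⁻¹) ^ 2 * reg x ((c⁻¹) ^ 2) y ^ (k + 2)) • g y) atTop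
      (𝓝 (regMass ι k • g x)) := by
  have hM := regMass_pos hk
  -- The decay `|y|ⁿ φ(y) → 0` lets `g` be merely integrable, continuous only at `x`.
  have hlim : Tendsto (fun y : EuclideanSpace ℝ ι => ‖y‖ ^ (2 * k + 2) *
      ((regMass ι k)⁻¹ * (1 + ‖y‖ ^ 2)⁻¹ ^ (k + 2))) (Bornology.cobounded _) (𝓝 0) := by
    have h1 : Tendsto (fun y : EuclideanSpace ℝ ι => (regMass ι k)⁻¹ * (1 + ‖y‖ ^ 2)⁻¹)
        (Bornology.cobounded _) (𝓝 ((regMass ι k)⁻¹ * 0)) := by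
      refine Tendsto.const_mul _ (tendsto_inv_atTop_zero.comp ?_)
      exact tendsto_atTop_add_const_left _ _
        ((tendsto_pow_atTop two_ne_zero).comp tendsto_norm_cobounded_atTop)
    rw [mul_zero] at h1
    refine squeeze_zero (fun y => by positivity) (fun y => ?_) h1
    have h2 : ‖y‖ ^ (2 * k + 2) * (1 + ‖y‖ ^ 2)⁻¹ ^ (k + 1) ≤ 1 := by
      rw [show 2 * k + 2 = 2 * (k + 1) by ring, pow_mul, ← mul_pow]
      refine pow_le_one₀ (by positivity) ?_
      rw [← div_eq_mul_inv, div_le_one (by positivity)]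
      linarith
    calc ‖y‖ ^ (2 * k + 2) * ((regMass ι k)⁻¹ * (1 + ‖y‖ ^ 2)⁻¹ ^ (k + 2))
        = (‖y‖ ^ (2 * k + 2) * (1 + ‖y‖ ^ 2)⁻¹ ^ (k + 1)) *
          ((regMass ι k)⁻¹ * (1 + ‖y‖ ^ 2)⁻¹) := by ring
      _ ≤ 1 * ((regMass ι k)⁻¹ * (1 + ‖y‖ ^ 2)⁻¹) := by gcongr
      _ = _ := one_mul _
  have key := tendsto_integral_comp_smul_smul_of_integrable' (μ := volume) (x₀ := x) (g := g)
    (φ := fun y : EuclideanSpace ℝ ι => (regMass ι k)⁻¹ * (1 + ‖y‖ ^ 2)⁻¹ ^ (k + 2))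
    (fun y => by positivity) (by
      rw [integral_const_mul]; exact inv_mul_cancel₀ hM.ne')
    (by rw [finrank_euclideanSpace, hk]; exact hlim) hg hx
  have key2 := key.const_smul (regMass ι k)
  refine key2.congr' ?_
  filter_upwards [eventually_gt_atTop 0] with c hc
  rw [← integral_smul]
  refine integral_congr_ae (Eventually.of_forall fun y => ?_)
  simp only [smul_smul]
  congr 1
  rw [finrank_euclideanSpace, hk, reg, norm_smul, Real.norm_of_nonneg hc.le]
  have e1 : (1 + (c * ‖x - y‖) ^ 2)⁻¹ = (c⁻¹) ^ 2 * (‖x - y‖ ^ 2 + (c⁻¹) ^ 2)⁻¹ := by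
    have : 0 < ‖x - y‖ ^ 2 + (c⁻¹) ^ 2 := by positivity
    field_simp
    ring
  have e2 : c ^ (2 * k + 2) * c ^ 2 * (c⁻¹) ^ (2 * (k + 2)) = 1 := by
    rw [← pow_add, show 2 * k + 2 + 2 = 2 * (k + 2) by ring, ← mul_pow, mul_inv_cancel₀ hc.ne',
      one_pow]
  have e3 : c⁻¹ ^ 2 * c ^ 2 = 1 := by rw [← mul_pow, inv_mul_cancel₀ hc.ne', one_pow]
  rw [e1, mul_pow, ← pow_mul]
  set A := (‖x - y‖ ^ 2 + c⁻¹ ^ 2)⁻¹ ^ (k + 2)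
  have e4 := mul_inv_cancel₀ hM.ne'
  linear_combination (c ^ (2 * k + 2) * c⁻¹ ^ (2 * (k + 2)) * A) * e4 + c⁻¹ ^ 2 * A * e2 -
    c ^ (2 * k + 2) * c⁻¹ ^ (2 * (k + 2)) * A * e3


theorem integrable_smul_of_tsupport_subset {u : EuclideanSpace ℝ ι → W}
    {U : Set (EuclideanSpace ℝ ι)} (hU : IsOpen U) (hu : ContinuousOn u U)
    {a : EuclideanSpace ℝ ι → ℝ} (ha : Continuous a) (hc : HasCompactSupport a)
    (hs : tsupport a ⊆ U) : Integrable fun y => a y • u y := by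
  refine Continuous.integrable_of_hasCompactSupport ?_ hc.smul_right
  refine continuous_of_tsupport fun y hy => ?_
  exact ha.continuousAt.smul
    (hu.continuousAt (hU.mem_nhds (hs (tsupport_smul_subset_left a u hy))))

/-- Through such functionals, the dependence of an integral on a parameter reduces to that of a map
into the Banach algebra of continuous functions. -/
theorem exists_integral_clm [CompleteSpace W] {X : Type*} [TopologicalSpace X] [CompactSpace X]
    [MeasurableSpace X] [BorelSpace X] (μ : Measure X) [IsFiniteMeasure μ] {g : X → W}
    (hg : Continuous g) :
    ∃ L : C(X, ℝ) →L[ℝ] W, ∀ κ, L κ = ∫ x, κ x • g x ∂μ := by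
  have hi : ∀ κ : C(X, ℝ), Integrable (fun x => κ x • g x) μ := fun κ =>
    (κ.continuous.smul hg).integrable_of_hasCompactSupport
      (HasCompactSupport.of_compactSpace _)
  have hgn : Integrable (fun x => ‖g x‖) μ :=
    hg.norm.integrable_of_hasCompactSupport (HasCompactSupport.of_compactSpace _)
  refine ⟨LinearMap.mkContinuous
    { toFun := fun κ => ∫ x, κ x • g x ∂μ
      map_add' := fun κ κ' => by
        rw [← integral_add (hi κ) (hi κ')]
        simp [add_smul]
      map_smul' := fun c κ => by
        rw [RingHom.id_apply, ← integral_smul]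
        simp [mul_smul] } (∫ x, ‖g x‖ ∂μ) fun κ => ?_, fun κ => rfl⟩
  refine (norm_integral_le_integral_norm _).trans ?_
  rw [mul_comm, ← integral_const_mul]
  refine integral_mono (hi κ).norm (hgn.const_mul _) fun x => ?_
  simp only [norm_smul]
  gcongr
  exact κ.norm_coe_le_norm x

variable [DecidableEq ι]

/-- The representation of a weakly harmonic function through the regularized kernel. -/
theorem WeaklyHarmonicOn.integral_reg {u : EuclideanSpace ℝ ι → W} {U : Set (EuclideanSpace ℝ ι)}
    (hu : WeaklyHarmonicOn u U) (hU : IsOpen U) {χ : EuclideanSpace ℝ ι → ℝ} (hχ : ContDiff ℝ 2 χ)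
    (hc : HasCompactSupport χ) (hs : tsupport χ ⊆ U) {k : ℕ} (hk : Fintype.card ι = 2 * k + 2)
    (x : EuclideanSpace ℝ ι) {t : ℝ} (ht : 0 < t) :
    (4 * k * (k + 1) : ℝ) • ∫ y, (t * reg x t y ^ (k + 2)) • (χ y • u y) =
      ∫ y, (reg x t y ^ k * ∑ i, pd i (pd i χ) y +
        ∑ i, (x i - y i) * reg x t y ^ (k + 1) * (4 * k * pd i χ y)) • u y := by
  have hN : ContDiff ℝ 2 fun y => reg x t y ^ k := (contDiff_reg x ht).pow k
  have hr : Continuous (reg x t) := (contDiff_reg x ht (n := 0)).continuous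
  have hcu : ∀ a : EuclideanSpace ℝ ι → ℝ, Continuous a → (∀ y, y ∉ tsupport χ → a y = 0) →
      Integrable fun y => a y • u y := by
    intro a ha hsub
    have hsub' : tsupport a ⊆ tsupport χ :=
      closure_minimal (fun y hy => by_contra fun h => hy (hsub y h)) (isClosed_tsupport χ)
    exact integrable_smul_of_tsupport_subset hU hu.cont ha
      (hc.of_isClosed_subset (isClosed_tsupport a) hsub') (hsub'.trans hs)
  -- For `t > 0` the kernel is smooth, so its product with the cut-off is an admissible test
  -- function.
  have h := hu.integral_eq_zero (fun y => χ y * reg x t y ^ k) (hχ.mul hN) hc.mul_right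
    ((tsupport_mul_subset_left).trans hs)
  have h1 : ∀ i, Continuous (pd i χ) := fun i =>
    (contDiff_pd hχ (m := 1) (by norm_num) i).continuous
  have h2 : ∀ i, Continuous (pd i (pd i χ)) := fun i =>
    (contDiff_pd (contDiff_pd hχ (m := 1) (by norm_num) i) (m := 0) (by norm_num) i).continuous
  have z1 : ∀ i, ∀ y ∉ tsupport χ, pd i χ y = 0 := fun i y hy =>
    image_eq_zero_of_notMem_tsupport fun h => hy (tsupport_fderiv_apply_subset ℝ _ h)
  have z2 : ∀ i, ∀ y ∉ tsupport χ, pd i (pd i χ) y = 0 := fun i y hy =>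
    image_eq_zero_of_notMem_tsupport fun h =>
      hy (tsupport_fderiv_apply_subset ℝ _ (tsupport_fderiv_apply_subset ℝ _ h))
  have i1 := hcu (fun y => t * reg x t y ^ (k + 2) * χ y)
    ((continuous_const.mul (hr.pow _)).mul hχ.continuous)
    (fun y hy => by rw [image_eq_zero_of_notMem_tsupport hy, mul_zero])
  have i2 := hcu (fun y => reg x t y ^ k * ∑ i, pd i (pd i χ) y +
        ∑ i, (x i - y i) * reg x t y ^ (k + 1) * (4 * k * pd i χ y))
    (by fun_prop) (fun y hy => by simp [z1 _ y hy, z2 _ y hy])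
  -- Leibniz: the term without derivatives of `χ` is the approximate identity; all others live where
  -- `χ` is not locally constant, away from the singularity.
  have hpt : ∀ y, (∑ i, pd i (pd i fun y => χ y * reg x t y ^ k) y) • u y =
      (reg x t y ^ k * ∑ i, pd i (pd i χ) y +
        ∑ i, (x i - y i) * reg x t y ^ (k + 1) * (4 * k * pd i χ y)) • u y -
      (4 * k * (k + 1) : ℝ) • (t * reg x t y ^ (k + 2) * χ y) • u y := by
    intro y
    rw [smul_smul, ← sub_smul]
    congr 1
    simp_rw [pd_pd_mul hχ hN y, Finset.sum_add_distrib, ← Finset.mul_sum,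
      laplacian_reg_pow x ht hk, pd_reg_pow x ht]
    rw [Finset.mul_sum]
    have : ∀ i, 2 * (pd i χ y * (2 * k * (x i - y i) * reg x t y ^ (k + 1))) =
      (x i - y i) * reg x t y ^ (k + 1) * (4 * k * pd i χ y) := fun i => by ring
    simp_rw [this]
    ring
  have i3 : Integrable fun y => (4 * k * (k + 1) : ℝ) • (t * reg x t y ^ (k + 2) * χ y) • u y :=
    i1.smul _
  simp_rw [hpt] at h
  rw [integral_sub i2 i3, integral_smul, sub_eq_zero] at h
  rw [h]
  simp_rw [smul_smul]

end Weyl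

/-! ### The representation through the Banach algebra `C(S)` -/

section Weyl
variable {ι : Type*} [Fintype ι] {W : Type*} [NormedAddCommGroup W] [NormedSpace ℝ W]

/-- The `i`-th coordinate as a continuous function on a set. -/
def coordOn (S : Set (EuclideanSpace ℝ ι)) (i : ι) : C(S, ℝ) := ⟨fun y => y.1 i, by fun_prop⟩

/-- The function `y ↦ |x - y|²` on a set. -/
def sqDistOn (S : Set (EuclideanSpace ℝ ι)) (x : EuclideanSpace ℝ ι) : C(S, ℝ) :=
  ∑ i, (algebraMap ℝ C(S, ℝ) (x i) - coordOn S i) ^ 2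

theorem sqDistOn_apply (S : Set (EuclideanSpace ℝ ι)) (x : EuclideanSpace ℝ ι) (y : S) :
    sqDistOn S x y = ‖x - y‖ ^ 2 := by
  rw [EuclideanSpace.norm_sq_eq]
  simp [sqDistOn, coordOn]

theorem inverse_apply_of_isUnit {X : Type*} [TopologicalSpace X] {f : C(X, ℝ)} (hf : IsUnit f)
    (y : X) : Ring.inverse f y = (f y)⁻¹ := by
  have := congrArg (fun g : C(X, ℝ) => g y) (Ring.inverse_mul_cancel f hf)
  exact eq_inv_of_mul_eq_one_left this

/-- The case `t = 0` is included, so the regularization can be removed inside `C(S)`. -/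
theorem isUnit_sqDistOn_add {S : Set (EuclideanSpace ℝ ι)} {x : EuclideanSpace ℝ ι} (hx : x ∉ S)
    {t : ℝ} (ht : 0 ≤ t) : IsUnit (sqDistOn S x + algebraMap ℝ C(S, ℝ) t) := by
  rw [ContinuousMap.isUnit_iff_forall_ne_zero]
  intro y
  have : 0 < ‖x - y‖ := norm_pos_iff.2 (sub_ne_zero.2 fun h => hx (h ▸ y.2))
  simp only [ContinuousMap.add_apply, sqDistOn_apply, algebraMap_apply, smul_eq_mul, mul_one]
  positivity

theorem isUnit_sqDistOn {S : Set (EuclideanSpace ℝ ι)} {x : EuclideanSpace ℝ ι} (hx : x ∉ S) :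
    IsUnit (sqDistOn S x) := by
  simpa using isUnit_sqDistOn_add hx le_rfl

theorem inverse_sqDistOn_add_apply {S : Set (EuclideanSpace ℝ ι)} {x : EuclideanSpace ℝ ι}
    (hx : x ∉ S) {t : ℝ} (ht : 0 ≤ t) (y : S) :
    Ring.inverse (sqDistOn S x + algebraMap ℝ C(S, ℝ) t) y = reg x t y := by
  rw [inverse_apply_of_isUnit (isUnit_sqDistOn_add hx ht), reg]
  simp [sqDistOn_apply]

variable [DecidableEq ι]

/-- Near a point, a weakly harmonic function is given by continuous linear functionals of negative
powers of the distance to a compact set. -/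
theorem WeaklyHarmonicOn.exists_representation [CompleteSpace W] {u : EuclideanSpace ℝ ι → W}
    {U : Set (EuclideanSpace ℝ ι)}
    (hu : WeaklyHarmonicOn u U) (hU : IsOpen U) {k : ℕ} (hk0 : k ≠ 0)
    (hk : Fintype.card ι = 2 * k + 2) {x₀ : EuclideanSpace ℝ ι} (hx₀ : x₀ ∈ U) :
    ∃ (S : Set (EuclideanSpace ℝ ι)) (_ : CompactSpace S) (L₀ : C(S, ℝ) →L[ℝ] W)
      (L : ι → C(S, ℝ) →L[ℝ] W), x₀ ∉ S ∧
      ∀ᶠ x in 𝓝 x₀, u x = L₀ (Ring.inverse (sqDistOn S x) ^ k) +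
        ∑ i, L i ((algebraMap ℝ C(S, ℝ) (x i) - coordOn S i) *
          Ring.inverse (sqDistOn S x) ^ (k + 1)) := by
  obtain ⟨R, hR, hRU⟩ := Metric.nhds_basis_closedBall.mem_iff.1 (hU.mem_nhds hx₀)
  let χ : ContDiffBump x₀ := ⟨R / 2, R, half_pos hR, half_lt_self hR⟩
  have hχ : ContDiff ℝ 2 (χ : EuclideanSpace ℝ ι → ℝ) := χ.contDiff
  have hsupp : tsupport (χ : EuclideanSpace ℝ ι → ℝ) = closedBall x₀ R := χ.tsupport_eq
  have hχ1 : ∀ y ∈ ball x₀ (R / 2), ∀ᶠ z in 𝓝 y, χ z = 1 := fun y hy => by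
    filter_upwards [isOpen_ball.mem_nhds hy] with z hz using χ.one_of_mem_closedBall
      (ball_subset_closedBall hz)
  set S : Set (EuclideanSpace ℝ ι) := closedBall x₀ R \ ball x₀ (R / 2) with hS
  have hSc : IsCompact S := (isCompact_closedBall x₀ R).diff isOpen_ball
  have : CompactSpace S := isCompact_iff_compactSpace.1 hSc
  have hpd : ∀ (ψ : EuclideanSpace ℝ ι → ℝ) (c : ℝ) (y : EuclideanSpace ℝ ι),
      (∀ᶠ z in 𝓝 y, ψ z = c) → ∀ i, ∀ᶠ z in 𝓝 y, pd i ψ z = 0 := by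
    intro ψ c y h i
    filter_upwards [h.eventually_nhds] with z hz
    have : ψ =ᶠ[𝓝 z] fun _ => c := hz
    rw [pd, this.fderiv_eq]
    simp
  -- Off the shell `S` the cut-off is locally `1` or `0`, so its derivatives are concentrated on
  -- `S`.
  have hloc : ∀ y ∉ S, ∃ c : ℝ, ∀ᶠ z in 𝓝 y, χ z = c := by
    intro y hy
    by_cases hy1 : y ∈ ball x₀ (R / 2)
    · exact ⟨1, hχ1 y hy1⟩
    · refine ⟨0, ?_⟩
      have hy2 : y ∉ closedBall x₀ R := fun h => hy ⟨h, hy1⟩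
      filter_upwards [isClosed_closedBall.isOpen_compl.mem_nhds hy2] with z hz
      exact image_eq_zero_of_notMem_tsupport (by rw [hsupp]; exact hz)
  have z1 : ∀ i, ∀ y ∉ S, pd i χ y = 0 := fun i y hy => by
    obtain ⟨c, hc⟩ := hloc y hy
    exact (hpd _ c y hc i).self_of_nhds
  have z2 : ∀ i, ∀ y ∉ S, pd i (pd i χ) y = 0 := fun i y hy => by
    obtain ⟨c, hc⟩ := hloc y hy
    exact (hpd _ 0 y (hpd _ c y hc i) i).self_of_nhds
  have h1 : ∀ i, Continuous (pd i χ) := fun i =>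
    (contDiff_pd hχ (m := 1) (by norm_num) i).continuous
  have h2 : ∀ i, Continuous (pd i (pd i χ)) := fun i =>
    (contDiff_pd (contDiff_pd hχ (m := 1) (by norm_num) i) (m := 0) (by norm_num) i).continuous
  have huS : Continuous fun y : S => u y :=
    (hu.cont.mono (sdiff_subset.trans hRU)).domRestrict
  have : IsFiniteMeasure (volume.comap (Subtype.val : S → EuclideanSpace ℝ ι)) :=
    ⟨by
      rw [comap_subtype_coe_apply hSc.measurableSet]
      exact (measure_mono (by simp)).trans_lt hSc.measure_lt_top⟩
  have hM := regMass_pos hk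
  have hkpos : (0 : ℝ) < k := by exact_mod_cast Nat.pos_of_ne_zero hk0
  -- The normalization of the Newtonian kernel: the Laplacian contributes `4k(k+1)`, the approximate
  -- identity its mass. It is nonzero because `k ≠ 0`.
  set A : ℝ := (4 * k * (k + 1) : ℝ) * regMass ι k with hA
  have hApos : 0 < A := by positivity
  have hg0 : Continuous fun y : S => (A⁻¹ * ∑ i, pd i (pd i χ) y) • u y :=
    ((continuous_const.mul (continuous_finsetSum _ fun i _ => h2 i)).comp
      continuous_subtype_val).smul huS
  have hg1 : ∀ i, Continuous fun y : S => (A⁻¹ * (4 * k * pd i χ y)) • u y := fun i =>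
    ((continuous_const.mul (continuous_const.mul (h1 i))).comp continuous_subtype_val).smul huS
  obtain ⟨L₀, hL₀⟩ := exists_integral_clm
    (volume.comap (Subtype.val : S → EuclideanSpace ℝ ι)) hg0
  have hLi : ∀ i, ∃ L : C(S, ℝ) →L[ℝ] W, ∀ κ, L κ =
      ∫ y, κ y • (A⁻¹ * (4 * k * pd i χ (y : EuclideanSpace ℝ ι))) • u y
        ∂(volume.comap (Subtype.val : S → EuclideanSpace ℝ ι)) := fun i =>
    exists_integral_clm _ (hg1 i)
  choose L hL using hLi
  have hball : ∀ x ∈ ball x₀ (R / 2), x ∉ S := fun x hx h => h.2 hx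
  refine ⟨S, inferInstance, L₀, L, hball x₀ (mem_ball_self (half_pos hR)), ?_⟩
  filter_upwards [ball_mem_nhds x₀ (half_pos hR)] with x hx
  have hxS := hball x hx
  -- The right-hand side as a function of the squared distance, so that `t → 0` becomes continuity
  -- of `Ψ` at an invertible element. The two limits of `Ψ` along `t = c⁻²` give the formula.
  set Ψ : C(S, ℝ) → W := fun w => L₀ (Ring.inverse w ^ k) +
        ∑ i, L i ((algebraMap ℝ C(S, ℝ) (x i) - coordOn S i) * Ring.inverse w ^ (k + 1)) with hΨ
  have hrep : ∀ t : ℝ, 0 < t → Ψ (sqDistOn S x + algebraMap ℝ C(S, ℝ) t) =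
      A⁻¹ • (4 * k * (k + 1) : ℝ) • ∫ y, (t * reg x t y ^ (k + 2)) • (χ y • u y) := by
    intro t ht
    rw [hu.integral_reg hU hχ χ.hasCompactSupport (hsupp.trans_subset hRU) hk x ht]
    have hfin : ∀ (κ : C(S, ℝ)) {g : S → W}, Continuous g → Integrable (fun y => κ y • g y)
        (volume.comap (Subtype.val : S → EuclideanSpace ℝ ι)) := fun κ g hg =>
      (κ.continuous.smul hg).integrable_of_hasCompactSupport (HasCompactSupport.of_compactSpace _)
    rw [← setIntegral_eq_integral_of_forall_compl_eq_zero (s := S)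
      (fun y hy => by simp [z1 _ y hy, z2 _ y hy]),
      ← integral_subtype_comap hSc.measurableSet, ← integral_smul]
    simp only [hΨ, hL₀, hL]
    rw [← integral_finsetSum _ fun i _ => hfin _ (hg1 i), ← integral_add (hfin _ hg0)
      (integrable_finsetSum _ fun i _ => hfin _ (hg1 i))]
    refine integral_congr_ae (Eventually.of_forall fun y => ?_)
    simp only [ContinuousMap.pow_apply, ContinuousMap.mul_apply, ContinuousMap.sub_apply,
      inverse_sqDistOn_add_apply hxS ht.le, smul_smul, ← Finset.sum_smul, ← add_smul]
    congr 1
    rw [mul_add]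
    congr 1
    · ring
    · rw [Finset.mul_sum]
      refine Finset.sum_congr rfl fun i _ => ?_
      simp [coordOn]
      ring
  have hlim1 : Tendsto (fun c : ℝ => Ψ (sqDistOn S x + algebraMap ℝ C(S, ℝ) ((c⁻¹) ^ 2))) atTop
      (𝓝 (Ψ (sqDistOn S x))) := by
    have hinv : ContinuousAt (Ring.inverse : C(S, ℝ) → C(S, ℝ)) (sqDistOn S x) :=
      NormedRing.inverse_continuousAt (isUnit_sqDistOn hxS).unit
    have hΨc : ContinuousAt Ψ (sqDistOn S x) := by
      rw [hΨ]
      fun_prop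
    refine hΨc.tendsto.comp ?_
    have : Tendsto (fun c : ℝ => algebraMap ℝ C(S, ℝ) ((c⁻¹) ^ 2)) atTop
        (𝓝 (algebraMap ℝ C(S, ℝ) (0 ^ 2))) :=
      ((algebraMapCLM ℝ C(S, ℝ)).continuous.tendsto _).comp (tendsto_inv_atTop_zero.pow 2)
    simpa using this.const_add (sqDistOn S x)
  have hlim2 : Tendsto (fun c : ℝ => Ψ (sqDistOn S x + algebraMap ℝ C(S, ℝ) ((c⁻¹) ^ 2))) atTop
      (𝓝 (u x)) := by
    have hi : Integrable fun y => χ y • u y :=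
      integrable_smul_of_tsupport_subset hU hu.cont hχ.continuous χ.hasCompactSupport
        (hsupp.trans_subset hRU)
    have hcx : ContinuousAt (fun y => χ y • u y) x :=
      hχ.continuous.continuousAt.smul (hu.cont.continuousAt (hU.mem_nhds (hRU
        (ball_subset_closedBall (ball_subset_ball (half_le_self hR.le) hx)))))
    have h := ((tendsto_integral_reg hk hi hcx).const_smul (4 * k * (k + 1) : ℝ)).const_smul A⁻¹
    rw [(hχ1 x hx).self_of_nhds, one_smul, smul_smul _ (regMass ι k), ← hA,
      inv_smul_smul₀ hApos.ne'] at h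
    refine h.congr' ?_
    filter_upwards [eventually_gt_atTop 0] with c hc
    rw [hrep _ (by positivity)]
  exact tendsto_nhds_unique hlim2 hlim1

end Weyl

/-! ### Symmetry of second derivatives -/

section SecondDerivatives
variable {E W : Type*} [NormedAddCommGroup E] [NormedSpace ℝ E] [NormedAddCommGroup W]
  [NormedSpace ℝ W]

theorem fderiv_fderiv_apply {f : E → W} {x : E} (hf : ContDiffAt ℝ 2 f x) (v w : E) :
    fderiv ℝ (fun y => fderiv ℝ f y v) x w = fderiv ℝ (fderiv ℝ f) x w v := by
  have h : DifferentiableAt ℝ (fderiv ℝ f) x :=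
    (hf.fderiv_right (m := 1) (by norm_num)).differentiableAt (by norm_num)
  rw [fderiv_clm_apply h (differentiableAt_const v)]
  simp

theorem fderiv_fderiv_apply_comm {f : E → W} {x : E} (hf : ContDiffAt ℝ 2 f x) (v w : E) :
    fderiv ℝ (fun y => fderiv ℝ f y v) x w = fderiv ℝ (fun y => fderiv ℝ f y w) x v := by
  rw [fderiv_fderiv_apply hf, fderiv_fderiv_apply hf]
  exact (hf.isSymmSndFDerivAt (by simp)).eq w v

theorem continuousOn_fderiv_apply {u : E → W} {U : Set (E)}
    (hU : IsOpen U) (hu : ContDiffOn ℝ 1 u U) (v : E) :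
    ContinuousOn (fun x => fderiv ℝ u x v) U :=
  (hu.continuousOn_fderiv_of_isOpen hU (by norm_num)).clm_apply continuousOn_const

end SecondDerivatives

/-! ### Weak harmonicity of solutions of Cauchy-Riemann systems -/

section WeakCauchyRiemann
variable {ι : Type*} [Fintype ι] [DecidableEq ι] {W : Type*} [NormedAddCommGroup W]
  [NormedSpace ℝ W]

theorem pd_comm {φ : EuclideanSpace ℝ ι → ℝ} (hφ : ContDiff ℝ 2 φ) (i j : ι) :
    pd i (pd j φ) = pd j (pd i φ) := by
  ext x
  exact fderiv_fderiv_apply_comm hφ.contDiffAt _ _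

theorem integral_pd_smul {u : EuclideanSpace ℝ ι → W} {U : Set (EuclideanSpace ℝ ι)}
    (hU : IsOpen U) (hu : ContDiffOn ℝ 1 u U) {φ : EuclideanSpace ℝ ι → ℝ} (hφ : ContDiff ℝ 1 φ)
    (hc : HasCompactSupport φ) (hs : tsupport φ ⊆ U) (i : ι) :
    ∫ x, pd i φ x • u x = -∫ x, φ x • fderiv ℝ u x (EuclideanSpace.single i 1) := by
  have hcp := (contDiff_pd hφ (m := 0) (by norm_num) i).continuous
  have h := integral_smul_fderiv_eq_neg_fderiv_smul_of_integrable (μ := volume) (f := φ) (g := u)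
    (v := EuclideanSpace.single i 1)
    (integrable_smul_of_tsupport_subset hU hu.continuousOn hcp
      (hc.fderiv_apply ℝ _) ((tsupport_fderiv_apply_subset ℝ _).trans hs))
    (integrable_smul_of_tsupport_subset hU (continuousOn_fderiv_apply hU hu _)
      hφ.continuous hc hs)
    (integrable_smul_of_tsupport_subset hU hu.continuousOn hφ.continuous hc hs)
    (fun x _ => hφ.differentiable (by norm_num) x)
    (fun x hx => (hu.contDiffAt (hU.mem_nhds (hs hx))).differentiableAt (by norm_num))
  rw [h, neg_neg]
  rfl

/-- This is `D̄ D = ∑ ∂ᵢ²`: symmetrizing the double sum in `i, j` leaves only the diagonal. The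
array `X` is abstract so that it can hold second derivatives as well as integrals against second
derivatives of a test function. -/
theorem clifford_sum_symm {α : Type*} [Fintype α] [DecidableEq α] {A B : α → W →L[ℝ] W}
    (hAB : ∀ i j w, B i (A j w) + B j (A i w) = if i = j then (2 : ℝ) • w else 0)
    {X : α → α → W} (hX : ∀ i j, X i j = X j i) : ∑ i, B i (∑ j, A j (X i j)) = ∑ i, X i i := by
  have e1 : ∑ i, B i (∑ j, A j (X i j)) = ∑ i, ∑ j, B i (A j (X i j)) := by
    simp only [map_sum]
  have e2 : ∑ i, ∑ j, B i (A j (X i j)) = ∑ i, ∑ j, B j (A i (X i j)) := by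
    rw [Finset.sum_comm]
    simp_rw [hX]
  have e3 : (2 : ℝ) • ∑ i, ∑ j, B i (A j (X i j)) = (2 : ℝ) • ∑ i, X i i := by
    rw [two_smul]
    nth_rewrite 2 [e2]
    simp_rw [← Finset.sum_add_distrib, hAB]
    simp [Finset.smul_sum]
  rw [e1, smul_right_injective W (two_ne_zero (α := ℝ)) e3]

/-- Solutions of a generalized Cauchy-Riemann system are weakly harmonic. The coordinates are
indexed by `α`, by `none` (the variable `r`), and by `some β` for the variables on which the
solution does not depend. -/
theorem weaklyHarmonicOn_of_cauchyRiemann [CompleteSpace W] {α β : Type*} [Fintype α]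
    [DecidableEq α] [Fintype β] [DecidableEq β] {u v : EuclideanSpace ℝ (α ⊕ Option β) → W}
    {U : Set (EuclideanSpace ℝ (α ⊕ Option β))} (hU : IsOpen U)
    (hu : ContDiffOn ℝ 1 u U) (hv : ContDiffOn ℝ 1 v U) {A B : α → W →L[ℝ] W}
    (hAB : ∀ i j w, B i (A j w) + B j (A i w) = if i = j then (2 : ℝ) • w else 0)
    (h1 : ∀ x ∈ U, ∑ i, A i (fderiv ℝ u x (EuclideanSpace.single (Sum.inl i) 1)) =
      fderiv ℝ v x (EuclideanSpace.single (Sum.inr none) 1))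
    (h2 : ∀ x ∈ U, ∑ i, B i (fderiv ℝ v x (EuclideanSpace.single (Sum.inl i) 1)) =
      -fderiv ℝ u x (EuclideanSpace.single (Sum.inr none) 1))
    (h3 : ∀ x ∈ U, ∀ j, fderiv ℝ u x (EuclideanSpace.single (Sum.inr (some j)) 1) = 0) :
    WeaklyHarmonicOn u U := by
  refine ⟨hu.continuousOn, fun φ hφ hc hs => ?_⟩
  set r : α ⊕ Option β := Sum.inr none with hr
  have d1 : ∀ i, ContDiff ℝ 1 (pd i φ) := fun i => contDiff_pd hφ (by norm_num) i
  have s1 : ∀ i, tsupport (pd i φ) ⊆ U := fun i => (tsupport_fderiv_apply_subset ℝ _).trans hs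
  have c1 : ∀ i, HasCompactSupport (pd i φ) := fun i => hc.fderiv_apply ℝ _
  have d2 : ∀ i j, Continuous (pd i (pd j φ)) := fun i j =>
    (contDiff_pd (d1 j) (m := 0) (by norm_num) i).continuous
  have ibp : ∀ {w : EuclideanSpace ℝ (α ⊕ Option β) → W}, ContDiffOn ℝ 1 w U → ∀ i j,
      ∫ x, pd i (pd j φ) x • w x =
        -∫ x, pd j φ x • fderiv ℝ w x (EuclideanSpace.single i 1) := fun hw i j =>
    integral_pd_smul hU hw (d1 j) (c1 j) (s1 j) i
  have int2 : ∀ {w : EuclideanSpace ℝ (α ⊕ Option β) → W}, ContDiffOn ℝ 1 w U → ∀ i j,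
      Integrable fun x => pd i (pd j φ) x • w x := fun hw i j =>
    integrable_smul_of_tsupport_subset hU hw.continuousOn (d2 i j) ((c1 j).fderiv_apply ℝ _)
      ((tsupport_fderiv_apply_subset ℝ _).trans (s1 j))
  have int1 : ∀ {w : EuclideanSpace ℝ (α ⊕ Option β) → W}, ContDiffOn ℝ 1 w U → ∀ i j,
      Integrable fun x => pd j φ x • fderiv ℝ w x (EuclideanSpace.single i 1) := fun hw i j =>
    integrable_smul_of_tsupport_subset hU (continuousOn_fderiv_apply hU hw _) (d1 j).continuous
      (c1 j) (s1 j)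
  have push : ∀ (T : α → W →L[ℝ] W) {w w' : EuclideanSpace ℝ (α ⊕ Option β) → W},
      ContDiffOn ℝ 1 w U →
      (∀ x ∈ U, ∑ i, T i (fderiv ℝ w x (EuclideanSpace.single (Sum.inl i) 1)) = w' x) → ∀ j,
      ∑ i, T i (∫ x, pd (Sum.inl i) (pd j φ) x • w x) = -∫ x, pd j φ x • w' x := by
    intro T w w' hw hT j
    simp_rw [ibp hw, map_neg, Finset.sum_neg_distrib]
    congr 1
    simp_rw [← ContinuousLinearMap.integral_comp_comm _ (int1 hw _ _)]
    rw [← integral_finsetSum _ fun i _ => (T i).integrable_comp (int1 hw _ _)]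
    refine integral_congr_ae (Eventually.of_forall fun x => ?_)
    by_cases hx : x ∈ U
    · simp only [map_smul, ← Finset.smul_sum, hT x hx]
    · have : pd j φ x = 0 := image_eq_zero_of_notMem_tsupport fun h => hx (s1 j h)
      simp [this]
  -- As `u` and `v` are only `C¹`, at most one derivative falls on them at a time: it is moved off
  -- `φ`, exchanged through the system for a derivative in `r`, and moved back. Doing this with `A`
  -- and then `B` replaces the derivatives in the variables `α` by `-∂ᵣ²`.
  have key : ∑ i, ∫ x, pd (Sum.inl i) (pd (Sum.inl i) φ) x • u x =
      -∫ x, pd r (pd r φ) x • u x := by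
    calc ∑ i, ∫ x, pd (Sum.inl i) (pd (Sum.inl i) φ) x • u x
        = ∑ i, B i (∑ j, A j (∫ x, pd (Sum.inl j) (pd (Sum.inl i) φ) x • u x)) := by
          refine (clifford_sum_symm hAB (X := fun i j => ∫ x, pd (Sum.inl j) (pd (Sum.inl i) φ) x • u x)
            fun i j => ?_).symm
          simp only [pd_comm hφ (Sum.inl i) (Sum.inl j)]
      _ = ∑ i, B i (∫ x, pd (Sum.inl i) (pd r φ) x • v x) := by
          refine Finset.sum_congr rfl fun i _ => ?_
          rw [push A hu h1, pd_comm hφ, ibp hv]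
      _ = -∫ x, pd r (pd r φ) x • u x := by
          rw [push B hv h2, ibp hu, neg_neg]
          simp_rw [smul_neg, integral_neg, neg_neg]
  have hdummy : ∀ j, ∫ x, pd (Sum.inr (some j)) (pd (Sum.inr (some j)) φ) x • u x = 0 := by
    intro j
    rw [ibp hu, neg_eq_zero]
    refine integral_eq_zero_of_ae (Eventually.of_forall fun x => ?_)
    by_cases hx : x ∈ U
    · simp [h3 x hx]
    · have : pd (Sum.inr (some j)) φ x = 0 :=
        image_eq_zero_of_notMem_tsupport fun h => hx (s1 _ h)
      simp [this]
  simp_rw [Finset.sum_smul]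
  rw [integral_finsetSum _ fun i _ => int2 hu i i, Fintype.sum_sum_type, key, Fintype.sum_option]
  simp [hdummy, hr]

end WeakCauchyRiemann

/-! ### Even and odd parts in `r` as analytic functions of `r²` -/

section Parity
variable {E W : Type*} [NormedAddCommGroup E] [NormedSpace ℝ E] [NormedAddCommGroup W]
  [NormedSpace ℝ W]

/-- Near `(y₀, 0)`, the function is of the form `g(y, r²) + r h(y, r²)` with `g` and `h` real
analytic. -/
def HasParitySplit (f : E × ℝ → W) (y₀ : E) : Prop :=
  ∃ g h : E × ℝ → W, AnalyticAt ℝ g (y₀, 0) ∧ AnalyticAt ℝ h (y₀, 0) ∧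
    ∀ᶠ z in 𝓝 (y₀, (0 : ℝ)), f z = g (z.1, z.2 ^ 2) + z.2 • h (z.1, z.2 ^ 2)

theorem tendsto_sq_snd {E : Type*} [TopologicalSpace E] (y₀ : E) :
    Tendsto (fun z : E × ℝ => (z.1, z.2 ^ 2)) (𝓝 (y₀, 0)) (𝓝 (y₀, 0)) := by
  have : Continuous fun z : E × ℝ => (z.1, z.2 ^ 2) := by fun_prop
  simpa using this.tendsto (y₀, (0 : ℝ))

namespace HasParitySplit

theorem of_fst {f : E → W} {y₀ : E} (hf : AnalyticAt ℝ f y₀) :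
    HasParitySplit (fun z : E × ℝ => f z.1) y₀ :=
  ⟨fun z => f z.1, 0, AnalyticAt.fun_comp (f := Prod.fst) hf analyticAt_fst, analyticAt_const,
    Eventually.of_forall fun z => by simp⟩

theorem const (c : W) (y₀ : E) : HasParitySplit (fun _ : E × ℝ => c) y₀ :=
  of_fst analyticAt_const

theorem snd_smul (c : W) (y₀ : E) : HasParitySplit (fun z : E × ℝ => z.2 • c) y₀ :=
  ⟨0, fun _ => c, analyticAt_const, analyticAt_const, Eventually.of_forall fun z => by simp⟩

theorem congr {f f' : E × ℝ → W} {y₀ : E} (hf : HasParitySplit f y₀)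
    (h : f' =ᶠ[𝓝 (y₀, 0)] f) : HasParitySplit f' y₀ := by
  obtain ⟨g, k, hg, hk, e⟩ := hf
  exact ⟨g, k, hg, hk, h.trans e⟩

theorem add {f f' : E × ℝ → W} {y₀ : E} (hf : HasParitySplit f y₀) (hf' : HasParitySplit f' y₀) :
    HasParitySplit (fun z => f z + f' z) y₀ := by
  obtain ⟨g, h, hg, hh, e⟩ := hf
  obtain ⟨g', h', hg', hh', e'⟩ := hf'
  refine ⟨g + g', h + h', hg.add hg', hh.add hh', ?_⟩
  filter_upwards [e, e'] with z hz hz'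
  simp only [hz, hz', Pi.add_apply]
  module

theorem sum {α : Type*} {f : α → E × ℝ → W} {y₀ : E} (s : Finset α)
    (hf : ∀ i ∈ s, HasParitySplit (f i) y₀) : HasParitySplit (fun z => ∑ i ∈ s, f i z) y₀ := by
  classical
  induction s using Finset.induction_on with
  | empty => simpa using const 0 y₀
  | insert i s hi ih =>
    simp_rw [Finset.sum_insert hi]
    exact (hf i (Finset.mem_insert_self i s)).add
      (ih fun j hj => hf j (Finset.mem_insert_of_mem hj))

theorem clm_comp {V : Type*} [NormedAddCommGroup V] [NormedSpace ℝ V] (L : W →L[ℝ] V)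
    {f : E × ℝ → W} {y₀ : E} (hf : HasParitySplit f y₀) :
    HasParitySplit (fun z => L (f z)) y₀ := by
  obtain ⟨g, h, hg, hh, e⟩ := hf
  refine ⟨fun z => L (g z), fun z => L (h z), (L.analyticAt _).fun_comp hg, (L.analyticAt _).fun_comp hh, ?_⟩
  filter_upwards [e] with z hz
  rw [hz, map_add, map_smul]

variable {A : Type*} [NormedCommRing A] [NormedAlgebra ℝ A]

theorem mul {f f' : E × ℝ → A} {y₀ : E} (hf : HasParitySplit f y₀) (hf' : HasParitySplit f' y₀) :
    HasParitySplit (fun z => f z * f' z) y₀ := by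
  obtain ⟨g, h, hg, hh, e⟩ := hf
  obtain ⟨g', h', hg', hh', e'⟩ := hf'
  refine ⟨fun z => g z * g' z + z.2 • (h z * h' z), fun z => g z * h' z + h z * g' z,
    (hg.mul hg').add (analyticAt_snd.smul (hh.mul hh')), (hg.mul hh').add (hh.mul hg'), ?_⟩
  filter_upwards [e, e'] with z hz hz'
  simp only [hz, hz', Algebra.smul_def, map_pow]
  ring

theorem pow {f : E × ℝ → A} {y₀ : E} (hf : HasParitySplit f y₀) (n : ℕ) :
    HasParitySplit (fun z => f z ^ n) y₀ := by
  induction n with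
  | zero => simpa using const 1 y₀
  | succ n ih => simpa only [pow_succ] using ih.mul hf

/-- Rationalizing the denominator: `(g + r h)⁻¹ = (g - r h) (g² - r² h²)⁻¹`, where the norm `N = g²
- s h²` depends on `r` only through `s = r²` and is invertible near `s = 0` because `g` is. -/
theorem inverse [CompleteSpace A] {f : E × ℝ → A} {y₀ : E} (hf : HasParitySplit f y₀)
    (hu : IsUnit (f (y₀, 0))) : HasParitySplit (fun z => Ring.inverse (f z)) y₀ := by
  obtain ⟨g, h, hg, hh, e⟩ := hf
  have hg0 : IsUnit (g (y₀, 0)) := by simpa [e.self_of_nhds] using hu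
  set N : E × ℝ → A := fun z => g z ^ 2 - z.2 • h z ^ 2 with hN
  have hNa : AnalyticAt ℝ N (y₀, 0) := (hg.pow 2).sub (analyticAt_snd.smul (hh.pow 2))
  have hN0 : IsUnit (N (y₀, 0)) := by simpa [hN] using hg0.pow 2
  have hNi : AnalyticAt ℝ (fun z => Ring.inverse (N z)) (y₀, 0) :=
    AnalyticAt.fun_comp (analyticAt_inverse (𝕜 := ℝ) hN0.unit) hNa
  refine ⟨fun z => g z * Ring.inverse (N z), fun z => -h z * Ring.inverse (N z), hg.mul hNi,
    hh.neg.mul hNi, ?_⟩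
  have hNu : ∀ᶠ z in 𝓝 (y₀, (0 : ℝ)), IsUnit (N (z.1, z.2 ^ 2)) :=
    (tendsto_sq_snd y₀).eventually (hNa.continuousAt.eventually
      (Units.isOpen.mem_nhds hN0))
  filter_upwards [e, hNu] with z hz hzN
  set w : E × ℝ := (z.1, z.2 ^ 2) with hw
  have h1 : f z * ((g w - z.2 • h w) * Ring.inverse (N w)) = 1 := by
    have h2 : f z * (g w - z.2 • h w) = N w := by
      simp only [hz, hN, hw, Algebra.smul_def, map_pow]
      ring
    rw [← mul_assoc, h2, Ring.mul_inverse_cancel _ hzN]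
  have h3 : Ring.inverse (f z) = (g w - z.2 • h w) * Ring.inverse (N w) := by
    rw [← mul_one (Ring.inverse (f z)), ← h1, ← mul_assoc,
      Ring.inverse_mul_cancel _ (IsUnit.of_mul_eq_one _ h1), one_mul]
  rw [h3, neg_mul, smul_neg, sub_mul, smul_mul_assoc, sub_eq_add_neg]

end HasParitySplit
end Parity

/-! ### Regularity of the solutions of the generalized Cauchy-Riemann equations -/

section Regularity
variable {p q : ℕ}

/-- The variables `(x_p, r)` together with `p + 2` further ones. -/
abbrev BigSpace (p : ℕ) : Type := EuclideanSpace ℝ (Fin (p + 1) ⊕ Option (Fin (p + 2)))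

/-- The inclusion of the variables `(x_p, r)`. -/
def bigIncl (p : ℕ) : HalfSpace p →L[ℝ] BigSpace p :=
  LinearMap.toContinuousLinearMap
    { toFun := fun z => WithLp.toLp 2 (Sum.elim z.1 fun o => o.elim z.2 fun _ => 0)
      map_add' := fun z w => by
        ext (i | _ | j) <;> simp
      map_smul' := fun c z => by
        ext (i | _ | j) <;> simp }

/-- The projection to the variables `(x_p, r)`. -/
def bigProj (p : ℕ) : BigSpace p →L[ℝ] HalfSpace p :=
  LinearMap.toContinuousLinearMap
    { toFun := fun x => (WithLp.toLp 2 fun i => x (Sum.inl i), x (Sum.inr none))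
      map_add' := fun z w => by
        ext <;> simp
      map_smul' := fun c z => by
        ext <;> simp }

theorem bigProj_bigIncl (z : HalfSpace p) : bigProj p (bigIncl p z) = z := by
  ext <;> simp [bigProj, bigIncl]

theorem bigProj_single_inl (i : Fin (p + 1)) :
    bigProj p (EuclideanSpace.single (Sum.inl i) 1) = (EuclideanSpace.single i 1, 0) := by
  ext j
  · by_cases h : j = i <;> simp [bigProj, h]
  · simp [bigProj]

theorem bigProj_single_none :
    bigProj p (EuclideanSpace.single (Sum.inr none) 1) = (0, 1) := by
  ext j <;> simp [bigProj]

theorem bigProj_single_some (j : Fin (p + 2)) :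
    bigProj p (EuclideanSpace.single (Sum.inr (some j)) 1) = 0 := by
  ext j <;> simp [bigProj]

theorem hasParitySplit_coord {A : Type*} [NormedCommRing A] [NormedAlgebra ℝ A]
    (i : Fin (p + 1) ⊕ Option (Fin (p + 2))) (y₀ : EuclideanSpace ℝ (Fin (p + 1))) :
    HasParitySplit (fun z : HalfSpace p => algebraMap ℝ A (bigIncl p z i)) y₀ := by
  rcases i with i | _ | j
  · exact HasParitySplit.of_fst (f := fun y : EuclideanSpace ℝ (Fin (p + 1)) => algebraMap ℝ A (y i))
      (((algebraMapCLM ℝ A).comp (EuclideanSpace.proj i)).analyticAt y₀)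
  · simpa [Algebra.algebraMap_eq_smul_one, bigIncl] using HasParitySplit.snd_smul (1 : A) y₀
  · simpa [bigIncl] using HasParitySplit.const (0 : A) y₀

theorem analyticAt_coord {A : Type*} [NormedCommRing A] [NormedAlgebra ℝ A]
    (i : Fin (p + 1) ⊕ Option (Fin (p + 2))) (z₀ : HalfSpace p) :
    AnalyticAt ℝ (fun z : HalfSpace p => algebraMap ℝ A (bigIncl p z i)) z₀ :=
  (((algebraMapCLM ℝ A).comp (EuclideanSpace.proj i)).comp (bigIncl p)).analyticAt z₀

variable {W : Type*} [NormedAddCommGroup W] [NormedSpace ℝ W] [CompleteSpace W]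

/-- The `p + 2` added variables bring the dimension to `2p + 4 = 2(p + 1) + 2`, so `k = p + 1` is a
nonzero integer whatever the parity of `p`. -/
theorem WeaklyHarmonicOn.exists_representation_half {F : HalfSpace p → W} {D : Set (HalfSpace p)}
    (hD : IsOpen D) (h : WeaklyHarmonicOn (fun x => F (bigProj p x)) (bigProj p ⁻¹' D))
    {z₀ : HalfSpace p} (hz₀ : z₀ ∈ D) :
    ∃ (S : Set (BigSpace p)) (_ : CompactSpace S) (L₀ : C(S, ℝ) →L[ℝ] W)
      (L : Fin (p + 1) ⊕ Option (Fin (p + 2)) → C(S, ℝ) →L[ℝ] W), bigIncl p z₀ ∉ S ∧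
      ∀ᶠ z in 𝓝 z₀, F z = L₀ (Ring.inverse (sqDistOn S (bigIncl p z)) ^ (p + 1)) +
        ∑ i, L i ((algebraMap ℝ C(S, ℝ) (bigIncl p z i) - coordOn S i) *
          Ring.inverse (sqDistOn S (bigIncl p z)) ^ (p + 2)) := by
  obtain ⟨S, hS, L₀, L, hzS, hL⟩ := h.exists_representation
    (hD.preimage (bigProj p).continuous) (k := p + 1) (by omega)
    (by simp; ring) (x₀ := bigIncl p z₀) (by simpa [bigProj_bigIncl] using hz₀)
  refine ⟨S, hS, L₀, L, hzS, ?_⟩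
  filter_upwards [(bigIncl p).continuous.continuousAt.eventually hL] with z hz
  simpa [bigProj_bigIncl] using hz

theorem WeaklyHarmonicOn.analyticAt_half {F : HalfSpace p → W} {D : Set (HalfSpace p)}
    (hD : IsOpen D) (h : WeaklyHarmonicOn (fun x => F (bigProj p x)) (bigProj p ⁻¹' D))
    {z₀ : HalfSpace p} (hz₀ : z₀ ∈ D) : AnalyticAt ℝ F z₀ := by
  obtain ⟨S, hS, L₀, L, hzS, hL⟩ := h.exists_representation_half hD hz₀
  have hc : ∀ i, AnalyticAt ℝ (fun z => algebraMap ℝ C(S, ℝ) (bigIncl p z i) - coordOn S i) z₀ :=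
    fun i => (analyticAt_coord i z₀).sub analyticAt_const
  have hs : AnalyticAt ℝ (fun z => sqDistOn S (bigIncl p z)) z₀ :=
    Finset.univ.analyticAt_fun_sum fun i _ => (hc i).fun_pow 2
  have hi : AnalyticAt ℝ (fun z => Ring.inverse (sqDistOn S (bigIncl p z))) z₀ :=
    AnalyticAt.fun_comp (analyticAt_inverse (𝕜 := ℝ) (isUnit_sqDistOn hzS).unit) hs
  refine AnalyticAt.congr ?_ (EventuallyEq.symm hL)
  exact ((L₀.analyticAt _).fun_comp (hi.fun_pow _)).fun_add (Finset.univ.analyticAt_fun_sum fun i _ =>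
    ((L i).analyticAt _).fun_comp ((hc i).fun_mul (hi.fun_pow _)))

/-- Each coordinate splits, and the representation is built from coordinates by sums, products, an
inverse and linear functionals. -/
theorem WeaklyHarmonicOn.hasParitySplit {F : HalfSpace p → W} {D : Set (HalfSpace p)}
    (hD : IsOpen D) (h : WeaklyHarmonicOn (fun x => F (bigProj p x)) (bigProj p ⁻¹' D))
    {y₀ : EuclideanSpace ℝ (Fin (p + 1))} (hy₀ : (y₀, (0 : ℝ)) ∈ D) : HasParitySplit F y₀ := by
  obtain ⟨S, hS, L₀, L, hzS, hL⟩ := h.exists_representation_half hD hy₀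
  have hc : ∀ i,
      HasParitySplit (fun z => algebraMap ℝ C(S, ℝ) (bigIncl p z i) - coordOn S i) y₀ := fun i => by
    simpa [sub_eq_add_neg] using (hasParitySplit_coord i y₀).add (.const (-coordOn S i) y₀)
  have hs : HasParitySplit (fun z => sqDistOn S (bigIncl p z)) y₀ :=
    .sum Finset.univ fun i _ => (hc i).pow 2
  have hi : HasParitySplit (fun z => Ring.inverse (sqDistOn S (bigIncl p z))) y₀ :=
    hs.inverse (isUnit_sqDistOn hzS)
  refine HasParitySplit.congr ?_ hL
  exact ((hi.pow _).clm_comp L₀).add (.sum Finset.univ fun i _ =>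
    ((hc i).mul (hi.pow _)).clm_comp (L i))

/-! ### The Clifford algebra as a finite-dimensional normed space -/

instance instFiniteDimensionalCl (n : ℕ) : FiniteDimensional ℝ (Cl n) :=
  Module.Finite.of_basis (clBasis n)

/-- Left multiplication by an element of the Clifford algebra. -/
def lmul {n : ℕ} (a : Cl n) : Cl n →L[ℝ] Cl n := LinearMap.toContinuousLinearMap (LinearMap.mulLeft ℝ a)

@[simp] theorem lmul_apply {n : ℕ} (a b : Cl n) : lmul a b = a * b := rfl

theorem e_mul_self {n : ℕ} (i : Fin n) : (e i * e i : Cl n) = -1 := by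
  have h := e_mul_e_add i i
  rw [if_pos rfl, ← two_smul ℝ] at h
  have h2 : (2 : ℝ) • (e i * e i : Cl n) = (2 : ℝ) • (-1) := by
    rw [h, Algebra.algebraMap_eq_smul_one]
    module
  exact smul_right_injective _ (two_ne_zero (α := ℝ)) h2

theorem e_mul_e_add_of_ne {n : ℕ} {i j : Fin n} (h : i ≠ j) : (e i * e j + e j * e i : Cl n) = 0 := by
  rw [e_mul_e_add, if_neg h, map_zero]

theorem unitConj_mul_unit_add (i j : Fin (p + 1)) :
    unitConj p q i * unit p q j + unitConj p q j * unit p q i = if i = j then 2 else 0 := by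
  refine Fin.cases ?_ (fun i => ?_) i <;> refine Fin.cases ?_ (fun j => ?_) j
  · simp [unit, unitConj, one_add_one_eq_two]
  · simp [unit, unitConj, (Fin.succ_ne_zero j).symm]
  · simp [unit, unitConj]
  · by_cases h : i = j
    · subst h
      simp [unit, unitConj, e_mul_self, one_add_one_eq_two]
    · have h' : Fin.castAdd q i ≠ Fin.castAdd q j := fun h' => h (Fin.castAdd_injective _ _ h')
      have := e_mul_e_add_of_ne h'
      simp only [unit, unitConj, Fin.cases_succ, neg_mul, Fin.succ_inj, h, if_false]
      rw [← neg_add, this, neg_zero]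

theorem unit_mul_unitConj_add (i j : Fin (p + 1)) :
    unit p q i * unitConj p q j + unit p q j * unitConj p q i = if i = j then 2 else 0 := by
  refine Fin.cases ?_ (fun i => ?_) i <;> refine Fin.cases ?_ (fun j => ?_) j
  · simp [unit, unitConj, one_add_one_eq_two]
  · simp [unit, unitConj, (Fin.succ_ne_zero j).symm]
  · simp [unit, unitConj]
  · by_cases h : i = j
    · subst h
      simp [unit, unitConj, e_mul_self, one_add_one_eq_two]
    · have h' : Fin.castAdd q i ≠ Fin.castAdd q j := fun h' => h (Fin.castAdd_injective _ _ h')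
      have := e_mul_e_add_of_ne h'
      simp only [unit, unitConj, Fin.cases_succ, mul_neg, Fin.succ_inj, h, if_false]
      rw [← neg_add, this, neg_zero]

theorem weaklyHarmonicOn_bigProj {D : Set (HalfSpace p)} (hD : IsOpen D)
    {F G : HalfSpace p → W} (hF : ContDiffOn ℝ 1 F D) (hG : ContDiffOn ℝ 1 G D)
    {A B : Fin (p + 1) → W →L[ℝ] W}
    (hAB : ∀ i j w, B i (A j w) + B j (A i w) = if i = j then (2 : ℝ) • w else 0)
    (h1 : ∀ z ∈ D, ∑ i, A i (fderiv ℝ F z (EuclideanSpace.single i 1, 0)) = fderiv ℝ G z (0, 1))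
    (h2 : ∀ z ∈ D, ∑ i, B i (fderiv ℝ G z (EuclideanSpace.single i 1, 0)) = -fderiv ℝ F z (0, 1)) :
    WeaklyHarmonicOn (fun x => F (bigProj p x)) (bigProj p ⁻¹' D) := by
  have hU : IsOpen (bigProj p ⁻¹' D) := hD.preimage (bigProj p).continuous
  have hd : ∀ {H : HalfSpace p → W}, ContDiffOn ℝ 1 H D → ∀ x ∈ bigProj p ⁻¹' D, ∀ v,
      fderiv ℝ (fun x => H (bigProj p x)) x v = fderiv ℝ H (bigProj p x) (bigProj p v) := by
    intro H hH x hx v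
    have hdH : DifferentiableAt ℝ H (bigProj p x) :=
      (hH.contDiffAt (hD.mem_nhds hx)).differentiableAt (by norm_num)
    rw [fderiv_fun_comp x hdH (bigProj p).differentiableAt, ContinuousLinearMap.fderiv]
    rfl
  refine weaklyHarmonicOn_of_cauchyRiemann hU (hF.comp_continuousLinearMap _)
    (v := fun x => G (bigProj p x)) (hG.comp_continuousLinearMap _) hAB ?_ ?_ ?_
  · intro x hx
    simpa only [hd hF x hx, hd hG x hx, bigProj_single_inl, bigProj_single_none] using h1 _ hx
  · intro x hx
    simpa only [hd hF x hx, hd hG x hx, bigProj_single_inl, bigProj_single_none] using h2 _ hx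
  · intro x hx j
    rw [hd hF x hx, bigProj_single_some, map_zero]

theorem weaklyHarmonicOn_fst_of_cauchyRiemann {D : Set (HalfSpace p)} (hD : IsOpen D)
    {F₁ F₂ : HalfSpace p → Cl (p + q)} (h₁ : ContDiffOn ℝ 1 F₁ D) (h₂ : ContDiffOn ℝ 1 F₂ D)
    (hCR : ∀ z ∈ D, diracHalf F₁ z - derivR F₂ z = 0 ∧ diracConjHalf F₂ z + derivR F₁ z = 0) :
    WeaklyHarmonicOn (fun x => F₁ (bigProj p x)) (bigProj p ⁻¹' D) := by
  refine weaklyHarmonicOn_bigProj hD h₁ h₂ (A := fun i => lmul (unit p q i))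
    (B := fun i => lmul (unitConj p q i)) (fun i j w => ?_) (fun z hz => ?_) fun z hz => ?_
  · simp only [lmul_apply, ← mul_assoc, ← add_mul, unitConj_mul_unit_add]
    split_ifs <;> simp [two_mul, two_smul]
  · exact sub_eq_zero.1 (hCR z hz).1
  · exact eq_neg_of_add_eq_zero_left (hCR z hz).2

/-- The pair `(F₂, -F₁)` solves the system with `D` and `D̄` exchanged. -/
theorem weaklyHarmonicOn_snd_of_cauchyRiemann {D : Set (HalfSpace p)} (hD : IsOpen D)
    {F₁ F₂ : HalfSpace p → Cl (p + q)} (h₁ : ContDiffOn ℝ 1 F₁ D) (h₂ : ContDiffOn ℝ 1 F₂ D)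
    (hCR : ∀ z ∈ D, diracHalf F₁ z - derivR F₂ z = 0 ∧ diracConjHalf F₂ z + derivR F₁ z = 0) :
    WeaklyHarmonicOn (fun x => F₂ (bigProj p x)) (bigProj p ⁻¹' D) := by
  refine weaklyHarmonicOn_bigProj hD h₂ h₁.neg (A := fun i => lmul (unitConj p q i))
    (B := fun i => lmul (unit p q i)) (fun i j w => ?_) (fun z hz => ?_) fun z hz => ?_
  · simp only [lmul_apply, ← mul_assoc, ← add_mul, unit_mul_unitConj_add]
    split_ifs <;> simp [two_mul, two_smul]
  · simp only [fderiv_fun_neg, neg_apply]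
    exact eq_neg_of_add_eq_zero_left (hCR z hz).2
  · simp only [fderiv_fun_neg, neg_apply, map_neg, Finset.sum_neg_distrib]
    exact congrArg Neg.neg (sub_eq_zero.1 (hCR z hz).1)

end Regularity

/-! ### Gluing local analytic functions of `(y, r²)` -/

section Gluing
variable {E W : Type*} [NormedAddCommGroup E] [NormedSpace ℝ E] [NormedAddCommGroup W]
  [NormedSpace ℝ W]

/-- The value at `s ≤ 0` of the analytic continuation of `σ ↦ Φ(y, σ)` from small `σ > 0`. -/
def IsContinuationValue {E : Type*} (Φ : E × ℝ → W) (w : E × ℝ) (v : W) : Prop :=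
  ∃ γ : ℝ → W, AnalyticOnNhd ℝ γ (Icc w.2 0) ∧ (∀ᶠ σ in 𝓝[>] (0 : ℝ), γ σ = Φ (w.1, σ)) ∧ γ w.2 = v

theorem IsContinuationValue.unique {E : Type*} {Φ : E × ℝ → W} {w : E × ℝ} {v v' : W} (hw : w.2 ≤ 0)
    (h : IsContinuationValue Φ w v) (h' : IsContinuationValue Φ w v') : v = v' := by
  obtain ⟨γ, hγ, he, rfl⟩ := h
  obtain ⟨γ', hγ', he', rfl⟩ := h'
  have hf : ∃ᶠ σ in 𝓝[≠] (0 : ℝ), γ σ = γ' σ := by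
    have h1 : ∀ᶠ σ in 𝓝[>] (0 : ℝ), γ σ = γ' σ := by
      filter_upwards [he, he'] with σ h h' using h.trans h'.symm
    exact h1.frequently.filter_mono (nhdsWithin_mono _ fun σ hσ => ne_of_gt hσ)
  exact hγ.eqOn_of_preconnected_of_frequently_eq hγ' isPreconnected_Icc
    (right_mem_Icc.2 hw) hf (left_mem_Icc.2 hw)

/-- Analyticity at `(y, 0)` involves values at `s < 0`, where `Φ` prescribes nothing and local
extensions at different `y` must agree. Continuation down the line `{y} × ℝ` makes the value at `(y,
s)` independent of the local extension, so one global function serves all points. -/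
theorem exists_analytic_extension [CompleteSpace W] {D : Set (E × ℝ)} {Φ : E × ℝ → W}
    (h : ∀ z ∈ D, ∃ g : E × ℝ → W, AnalyticAt ℝ g (z.1, z.2 ^ 2) ∧
      ∀ᶠ w in 𝓝 (z.1, z.2 ^ 2), 0 < w.2 → Φ w = g w) :
    ∃ G : E × ℝ → W, AnalyticOnNhd ℝ G ((fun z : E × ℝ => (z.1, z.2 ^ 2)) '' D) ∧
      ∀ w, 0 < w.2 → G w = Φ w := by
  classical
  refine ⟨fun w => if 0 < w.2 then Φ w else
    if hv : ∃ v, IsContinuationValue Φ w v then hv.choose else 0, ?_, fun w hw => if_pos hw⟩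
  rintro _ ⟨z, hz, rfl⟩
  obtain ⟨g, hg, hgΦ⟩ := h z hz
  refine hg.congr ?_
  by_cases hr : z.2 = 0
  · simp only [hr] at hg hgΦ ⊢
    rw [zero_pow two_ne_zero] at hg hgΦ ⊢
    obtain ⟨ε, hε, hb⟩ := Metric.eventually_nhds_iff_ball.1 (hg.eventually_analyticAt.and hgΦ)
    filter_upwards [ball_mem_nhds _ hε] with w hw
    by_cases hw2 : 0 < w.2
    · rw [if_pos hw2, (hb w hw).2 hw2]
    · rw [if_neg hw2]
      rw [mem_ball, Prod.dist_eq, max_lt_iff, Real.dist_eq, sub_zero] at hw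
      have hmem : ∀ σ : ℝ, |σ| < ε → (w.1, σ) ∈ ball (z.1, (0 : ℝ)) ε := fun σ hσ => by
        rw [mem_ball, Prod.dist_eq, max_lt_iff, Real.dist_eq, sub_zero]
        exact ⟨hw.1, hσ⟩
      -- The segment from `w` up to `s = 0` stays in the ball, so the local `g` restricted to it is
      -- a continuation.
      have hv : IsContinuationValue Φ w (g w) := by
        refine ⟨fun σ => g (w.1, σ), fun σ hσ => ?_, ?_, rfl⟩
        · have hσ' : |σ| < ε := by
            refine lt_of_le_of_lt ?_ hw.2
            rw [abs_of_nonpos hσ.2, abs_of_nonpos (hσ.1.trans hσ.2)]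
            linarith [hσ.1]
          exact (hb _ (hmem σ hσ')).1.fun_comp (analyticAt_const.prod analyticAt_id)
        · filter_upwards [Ioo_mem_nhdsGT hε] with σ hσ
          exact ((hb _ (hmem σ (by rw [abs_of_pos hσ.1]; exact hσ.2))).2 hσ.1).symm
      rw [dif_pos ⟨_, hv⟩]
      exact hv.unique (not_lt.1 hw2) (Exists.choose_spec (⟨_, hv⟩ : ∃ v, _))
  · have hpos : (0 : ℝ) < z.2 ^ 2 := by positivity
    have hev : ∀ᶠ w in 𝓝 (z.1, z.2 ^ 2), 0 < w.2 :=
      continuousAt_snd.eventually (lt_mem_nhds hpos)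
    filter_upwards [hev, hgΦ] with w hw hwg
    rw [if_pos hw, hwg hw]

theorem analyticAt_sqrt {s : ℝ} (hs : 0 < s) : AnalyticAt ℝ Real.sqrt s :=
  (Real.contDiffAt_sqrt (n := ⊤) hs.ne').analyticAt

theorem analyticAt_comp_sqrt {F : E × ℝ → W} {y : E} {s : ℝ} (hs : 0 < s)
    (hF : AnalyticAt ℝ F (y, √s)) : AnalyticAt ℝ (fun w : E × ℝ => F (w.1, √w.2)) (y, s) := by
  have h1 : AnalyticAt ℝ (fun w : E × ℝ => √w.2) (y, s) :=
    AnalyticAt.fun_comp (g := Real.sqrt) (analyticAt_sqrt hs) analyticAt_snd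
  exact AnalyticAt.fun_comp (f := fun w : E × ℝ => (w.1, √w.2)) hF (analyticAt_fst.prod h1)

theorem tendsto_sqrt_snd {E : Type*} [TopologicalSpace E] (y₀ : E) :
    Tendsto (fun w : E × ℝ => (w.1, √w.2)) (𝓝 (y₀, 0)) (𝓝 (y₀, 0)) := by
  have : Continuous fun w : E × ℝ => (w.1, √w.2) := by fun_prop
  simpa using this.tendsto (y₀, (0 : ℝ))

theorem tendsto_neg_sqrt_snd {E : Type*} [TopologicalSpace E] (y₀ : E) :
    Tendsto (fun w : E × ℝ => (w.1, -√w.2)) (𝓝 (y₀, 0)) (𝓝 (y₀, 0)) := by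
  have : Continuous fun w : E × ℝ => (w.1, -√w.2) := by fun_prop
  simpa using this.tendsto (y₀, (0 : ℝ))

/-- The two parts of a parity splitting, on `s = r² > 0`. -/
theorem HasParitySplit.eventually_sqrt {F : E × ℝ → W} {y₀ : E} (hF : HasParitySplit F y₀) :
    ∃ g h : E × ℝ → W, AnalyticAt ℝ g (y₀, 0) ∧ AnalyticAt ℝ h (y₀, 0) ∧
      ∀ᶠ w in 𝓝 (y₀, (0 : ℝ)), 0 < w.2 →
        F (w.1, √w.2) = g w + √w.2 • h w ∧ F (w.1, -√w.2) = g w - √w.2 • h w := by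
  obtain ⟨g, h, hg, hh, e⟩ := hF
  refine ⟨g, h, hg, hh, ?_⟩
  filter_upwards [(tendsto_sqrt_snd y₀).eventually e, (tendsto_neg_sqrt_snd y₀).eventually e]
    with w h1 h2 hw
  rw [h1, h2, neg_sq, Real.sq_sqrt hw.le, neg_smul, sub_eq_add_neg]
  exact ⟨rfl, rfl⟩

variable [CompleteSpace W] {D : Set (E × ℝ)} {F : E × ℝ → W}

theorem exists_analytic_of_even (hD : IsOpen D) (hsymm : ∀ y r, (y, r) ∈ D → (y, -r) ∈ D)
    (hF : AnalyticOnNhd ℝ F D) (hsplit : ∀ y, (y, (0 : ℝ)) ∈ D → HasParitySplit F y)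
    (heven : ∀ y r, (y, r) ∈ D → F (y, -r) = F (y, r)) :
    ∃ G : E × ℝ → W, AnalyticOnNhd ℝ G ((fun z : E × ℝ => (z.1, z.2 ^ 2)) '' D) ∧
      ∀ w, 0 < w.2 → G w = F (w.1, √w.2) := by
  refine exists_analytic_extension fun ⟨y, r⟩ hz => ?_
  by_cases hr : r = 0
  · subst hr
    obtain ⟨g, h, hg, hh, e⟩ := (hsplit y hz).eventually_sqrt
    refine ⟨g, by simpa using hg, ?_⟩
    rw [show ((y, (0 : ℝ)).1, (y, (0 : ℝ)).2 ^ 2) = (y, (0 : ℝ)) by simp]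
    filter_upwards [e, (tendsto_sqrt_snd y).eventually (hD.mem_nhds hz)] with w hw hwD hpos
    obtain ⟨h1, h2⟩ := hw hpos
    -- Evenness gives `g + √s h = g - √s h`, so the odd part vanishes for `s > 0`.
    rw [heven _ _ hwD, h1, sub_eq_add_neg, add_right_inj, eq_neg_iff_add_eq_zero, ← two_smul ℝ,
      smul_eq_zero] at h2
    rw [h1, h2.resolve_left two_ne_zero, add_zero]
  · refine ⟨fun w => F (w.1, √w.2), analyticAt_comp_sqrt (by positivity) (hF _ ?_),
      Eventually.of_forall fun w _ => rfl⟩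
    rw [Real.sqrt_sq_eq_abs]
    rcases abs_choice r with h | h <;> rw [h]
    exacts [hz, hsymm _ _ hz]

theorem exists_analytic_of_odd (hD : IsOpen D) (hsymm : ∀ y r, (y, r) ∈ D → (y, -r) ∈ D)
    (hF : AnalyticOnNhd ℝ F D) (hsplit : ∀ y, (y, (0 : ℝ)) ∈ D → HasParitySplit F y)
    (hodd : ∀ y r, (y, r) ∈ D → F (y, -r) = -F (y, r)) :
    ∃ G : E × ℝ → W, AnalyticOnNhd ℝ G ((fun z : E × ℝ => (z.1, z.2 ^ 2)) '' D) ∧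
      ∀ w, 0 < w.2 → G w = (√w.2)⁻¹ • F (w.1, √w.2) := by
  refine exists_analytic_extension fun ⟨y, r⟩ hz => ?_
  by_cases hr : r = 0
  · subst hr
    obtain ⟨g, h, hg, hh, e⟩ := (hsplit y hz).eventually_sqrt
    refine ⟨h, by simpa using hh, ?_⟩
    rw [show ((y, (0 : ℝ)).1, (y, (0 : ℝ)).2 ^ 2) = (y, (0 : ℝ)) by simp]
    filter_upwards [e, (tendsto_sqrt_snd y).eventually (hD.mem_nhds hz)] with w hw hwD hpos
    obtain ⟨h1, h2⟩ := hw hpos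
    -- Oddness gives `g = -g` for `s > 0`, and dividing by `√s` leaves `h`.
    rw [hodd _ _ hwD, h1, neg_add, ← sub_eq_add_neg, sub_left_inj, eq_comm,
      eq_neg_iff_add_eq_zero, ← two_smul ℝ, smul_eq_zero] at h2
    rw [h1, h2.resolve_left two_ne_zero, zero_add, inv_smul_smul₀ (Real.sqrt_pos.2 hpos).ne']
  · have hpos : 0 < r ^ 2 := by positivity
    have h1 : AnalyticAt ℝ (fun w : E × ℝ => √w.2) (y, r ^ 2) :=
      AnalyticAt.fun_comp (g := Real.sqrt) (analyticAt_sqrt hpos) analyticAt_snd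
    refine ⟨fun w => (√w.2)⁻¹ • F (w.1, √w.2), (h1.fun_inv (Real.sqrt_pos.2 hpos).ne').fun_smul
      (analyticAt_comp_sqrt hpos (hF _ ?_)), Eventually.of_forall fun w _ => rfl⟩
    rw [Real.sqrt_sq_eq_abs]
    rcases abs_choice r with h | h <;> rw [h]
    exacts [hz, hsymm _ _ hz]

end Gluing

/-! ### The set `Omega`, and the spherical value and derivative in terms of `F₁`, `F₂` -/

section Geometry
variable {p q : ℕ}

/-- The component `xp` as a continuous linear map. -/
def xpL (p q : ℕ) : Space p q →L[ℝ] EuclideanSpace ℝ (Fin (p + 1)) :=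
  LinearMap.toContinuousLinearMap
    { toFun := xp
      map_add' := fun _ _ => rfl
      map_smul' := fun _ _ => rfl }

/-- The component `xq` as a continuous linear map. -/
def xqL (p q : ℕ) : Space p q →L[ℝ] EuclideanSpace ℝ (Fin q) :=
  LinearMap.toContinuousLinearMap
    { toFun := xq
      map_add' := fun _ _ => rfl
      map_smul' := fun _ _ => rfl }

theorem xpL_apply (x : Space p q) : xpL p q x = xp x := rfl

theorem xqL_apply (x : Space p q) : xqL p q x = xq x := rfl

theorem continuous_xp : Continuous (xp : Space p q → _) := (xpL p q).continuous

theorem continuous_xq : Continuous (xq : Space p q → _) := (xqL p q).continuous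

@[simp] theorem xp_joinPt (y : EuclideanSpace ℝ (Fin (p + 1))) (v : EuclideanSpace ℝ (Fin q)) :
    xp (joinPt y v) = y := rfl

@[simp] theorem xq_joinPt (y : EuclideanSpace ℝ (Fin (p + 1))) (v : EuclideanSpace ℝ (Fin q)) :
    xq (joinPt y v) = v := rfl

theorem joinPt_xp_xq (x : Space p q) : joinPt (xp x) (xq x) = x := by
  ext (i | j) <;> rfl

theorem exists_norm_eq_one (hq : 1 ≤ q) : ∃ ω : EuclideanSpace ℝ (Fin q), ‖ω‖ = 1 :=
  ⟨EuclideanSpace.single ⟨0, hq⟩ 1, by simp⟩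

/-- Polar coordinates in the second component. -/
theorem exists_polar (hq : 1 ≤ q) (x : Space p q) :
    ∃ ω : EuclideanSpace ℝ (Fin q), ‖ω‖ = 1 ∧ x = joinPt (xp x) (‖xq x‖ • ω) := by
  by_cases h : xq x = 0
  · obtain ⟨ω, hω⟩ := exists_norm_eq_one hq
    refine ⟨ω, hω, ?_⟩
    nth_rewrite 1 [← joinPt_xp_xq x]
    rw [h, norm_zero, zero_smul]
  · have hn : ‖xq x‖ ≠ 0 := norm_ne_zero_iff.2 h
    refine ⟨‖xq x‖⁻¹ • xq x, by simp [norm_smul, hn], ?_⟩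
    rw [smul_inv_smul₀ hn, joinPt_xp_xq]

theorem mem_Omega_iff (hq : 1 ≤ q) {D : Set (HalfSpace p)} {x : Space p q} :
    x ∈ Omega q D ↔ (xp x, ‖xq x‖) ∈ D := by
  constructor
  · rintro ⟨y, r, ω, hω, hr, hD, rfl⟩
    simpa [norm_smul, hω, abs_of_nonneg hr] using hD
  · intro h
    obtain ⟨ω, hω, hx⟩ := exists_polar hq x
    exact ⟨_, _, ω, hω, norm_nonneg _, h, hx⟩

theorem isOpen_Omega (hq : 1 ≤ q) {D : Set (HalfSpace p)} (hD : IsOpen D) :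
    IsOpen (Omega q D) := by
  have : Omega q D = (fun x : Space p q => (xp x, ‖xq x‖)) ⁻¹' D := by
    ext x
    exact mem_Omega_iff hq
  rw [this]
  exact hD.preimage (continuous_xp.prodMk continuous_xq.norm)

theorem vec_smul (c : ℝ) (v : EuclideanSpace ℝ (Fin q)) : vec p (c • v) = c • vec p v := by
  simp [vec, Finset.smul_sum, smul_smul]

theorem vec_neg (v : EuclideanSpace ℝ (Fin q)) : vec p (-v) = -vec p v := by
  simp [vec]

theorem vec_mul_self (v : EuclideanSpace ℝ (Fin q)) :
    vec p v * vec p v = algebraMap ℝ (Cl (p + q)) (-‖v‖ ^ 2) := by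
  have h : vec p v = CliffordAlgebra.ι (negForm (p + q))
      (∑ j, v j • Pi.single (Fin.natAdd p j) (1 : ℝ)) := by
    simp [vec, e]
  rw [h, CliffordAlgebra.ι_sq_scalar]
  congr 1
  rw [negForm, QuadraticMap.weightedSumSquares_apply, Fin.sum_univ_add, EuclideanSpace.norm_sq_eq]
  have hne : ∀ (i : Fin p) (j : Fin q), Fin.castAdd q i ≠ Fin.natAdd p j := fun i j h => by
    have := congrArg Fin.val h
    simp only [Fin.val_castAdd, Fin.val_natAdd] at this
    omega
  simp [Finset.sum_apply, Pi.single_apply, sq, hne]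

theorem inverse_vec_mul {ω : EuclideanSpace ℝ (Fin q)} (hω : ‖ω‖ = 1) {r : ℝ} (hr : r ≠ 0)
    (a : Cl (p + q)) : Ring.inverse (vec p (r • ω)) * (vec p ω * a) = r⁻¹ • a := by
  have h1 : vec p ω * vec p ω = -1 := by
    rw [vec_mul_self, hω]
    simp
  have h2 : vec p (r • ω) * (-(r⁻¹ • vec p ω)) = 1 := by
    rw [vec_smul, mul_neg, smul_mul_smul_comm, h1, mul_inv_cancel₀ hr]
    simp
  have h3 : -(r⁻¹ • vec p ω) * vec p (r • ω) = 1 := by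
    rw [vec_smul, neg_mul, smul_mul_smul_comm, h1, inv_mul_cancel₀ hr]
    simp
  have h4 : Ring.inverse (vec p (r • ω)) = -(r⁻¹ • vec p ω) :=
    Ring.inverse_unit ⟨vec p (r • ω), -(r⁻¹ • vec p ω), h2, h3⟩
  rw [h4, ← mul_assoc, neg_mul, smul_mul_assoc, h1]
  simp

variable {D : Set (HalfSpace p)} {f : Space p q → Cl (p + q)} {F₁ F₂ : HalfSpace p → Cl (p + q)}

theorem reflPt_joinPt (y : EuclideanSpace ℝ (Fin (p + 1))) (v : EuclideanSpace ℝ (Fin q)) :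
    reflPt (joinPt y v) = joinPt y (-v) := rfl

theorem IsInducedBy.sphValue_eq (h : IsInducedBy D f F₁ F₂) {x : Space p q}
    (hx : x ∈ Omega q D) : sphValue f x = F₁ (xp x, ‖xq x‖) := by
  obtain ⟨y, r, ω, hω, hr, hD, rfl⟩ := hx
  rw [sphValue, reflPt_joinPt, ← smul_neg, h.eq y r ω hω hr hD,
    h.eq y r (-ω) (by rwa [norm_neg]) hr hD, vec_neg]
  simp only [xp_joinPt, xq_joinPt, norm_smul, hω, mul_one, Real.norm_of_nonneg hr, neg_mul]
  module

theorem IsInducedBy.sphDerivAux_eq (h : IsInducedBy D f F₁ F₂) {x : Space p q}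
    (hx : x ∈ Omega q D) (hx0 : xq x ≠ 0) :
    sphDerivAux f x = ‖xq x‖⁻¹ • F₂ (xp x, ‖xq x‖) := by
  obtain ⟨y, r, ω, hω, hr, hD, rfl⟩ := hx
  have hr0 : r ≠ 0 := fun h0 => hx0 (by simp [h0])
  rw [sphDerivAux, reflPt_joinPt, ← smul_neg, h.eq y r ω hω hr hD,
    h.eq y r (-ω) (by rwa [norm_neg]) hr hD, vec_neg]
  have e1 : F₁ (y, r) + vec p ω * F₂ (y, r) - (F₁ (y, r) + -vec p ω * F₂ (y, r)) =
      vec p ω * ((2 : ℝ) • F₂ (y, r)) := by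
    rw [neg_mul, mul_smul_comm]
    module
  rw [e1, xq_joinPt, inverse_vec_mul hω hr0]
  simp only [xp_joinPt, norm_smul, hω, mul_one, Real.norm_of_nonneg hr]
  module

/-- Makes limits from outside `ℝ^{p+1}` unique, so that `limUnder` in `sphDeriv` has a determined
value. -/
theorem neBot_nhdsWithin_xq_ne_zero (hq : 1 ≤ q) {x : Space p q} (hx : xq x = 0) :
    (𝓝[{y | xq y ≠ 0}] x).NeBot := by
  obtain ⟨ω, hω⟩ := exists_norm_eq_one hq
  have hω0 : ω ≠ 0 := norm_ne_zero_iff.1 (by rw [hω]; norm_num)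
  have h : Tendsto (fun t : ℝ => x + t • joinPt (0 : EuclideanSpace ℝ (Fin (p + 1))) ω) (𝓝[≠] 0)
      (𝓝[{y | xq y ≠ 0}] x) := by
    refine tendsto_nhdsWithin_iff.2 ⟨?_, ?_⟩
    · have : Continuous fun t : ℝ => x + t • joinPt (0 : EuclideanSpace ℝ (Fin (p + 1))) ω := by
        fun_prop
      simpa using (this.tendsto 0).mono_left nhdsWithin_le_nhds
    · filter_upwards [self_mem_nhdsWithin] with t ht
      have : xq (x + t • joinPt (0 : EuclideanSpace ℝ (Fin (p + 1))) ω) = t • ω := by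
        rw [← xqL_apply, map_add, map_smul, xqL_apply, xqL_apply, hx, xq_joinPt, zero_add]
      rw [this]
      exact smul_ne_zero ht hω0
  exact h.neBot

/-- The map `x ↦ (x_p, |x_q|²)`. -/
def sqMap (x : Space p q) : HalfSpace p := (xp x, ‖xq x‖ ^ 2)

theorem continuous_sqMap : Continuous (sqMap : Space p q → HalfSpace p) :=
  continuous_xp.prodMk (continuous_xq.norm.pow 2)

/-- The set of the points `(y, r²)` with `(y, r) ∈ D`. -/
abbrev sqImage (D : Set (HalfSpace p)) : Set (HalfSpace p) :=
  (fun z : HalfSpace p => (z.1, z.2 ^ 2)) '' D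

theorem sqMap_mem (hq : 1 ≤ q) {x : Space p q} (hx : x ∈ Omega q D) : sqMap x ∈ sqImage D :=
  ⟨_, (mem_Omega_iff hq).1 hx, rfl⟩

/-- The spherical value and the spherical derivative are real analytic functions of
`(x_p, |x_q|²)`. -/
theorem IsRegular.exists_isRepresentedBy (hq : 1 ≤ q) (hD : IsOpen D)
    (hsymm : ∀ y r, (y, r) ∈ D → (y, -r) ∈ D) (hf : IsRegular D f) :
    ∃ G₁ G₂ : HalfSpace p → Cl (p + q), IsRepresentedBy D f G₁ G₂ := by
  obtain ⟨F₁, F₂, h, hF₁, hF₂, hCR⟩ := hf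
  have hw₁ := weaklyHarmonicOn_fst_of_cauchyRiemann hD hF₁ hF₂ hCR
  have hw₂ := weaklyHarmonicOn_snd_of_cauchyRiemann hD hF₁ hF₂ hCR
  have : CompleteSpace (Cl (p + q)) := FiniteDimensional.complete ℝ _
  obtain ⟨G₁, hG₁, e₁⟩ := exists_analytic_of_even hD hsymm (fun z hz => hw₁.analyticAt_half hD hz)
    (fun y hy => hw₁.hasParitySplit hD hy) h.even
  obtain ⟨G₂, hG₂, e₂⟩ := exists_analytic_of_odd hD hsymm (fun z hz => hw₂.analyticAt_half hD hz)
    (fun y hy => hw₂.hasParitySplit hD hy) h.odd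
  have hv : ∀ x ∈ Omega q D, xq x ≠ 0 → sphValue f x = G₁ (sqMap x) := by
    intro x hx hx0
    have hpos : 0 < ‖xq x‖ := norm_pos_iff.2 hx0
    rw [h.sphValue_eq hx, e₁ _ (by simp only [sqMap]; positivity)]
    simp only [sqMap, Real.sqrt_sq hpos.le]
  have hd : ∀ x ∈ Omega q D, xq x ≠ 0 → sphDerivAux f x = G₂ (sqMap x) := by
    intro x hx hx0
    have hpos : 0 < ‖xq x‖ := norm_pos_iff.2 hx0
    rw [h.sphDerivAux_eq hx hx0, e₂ _ (by simp only [sqMap]; positivity)]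
    simp only [sqMap, Real.sqrt_sq hpos.le]
  have hlim : ∀ {G : HalfSpace p → Cl (p + q)}, AnalyticOnNhd ℝ G (sqImage D) →
      ∀ {g : Space p q → Cl (p + q)}, (∀ x ∈ Omega q D, xq x ≠ 0 → g x = G (sqMap x)) →
      ∀ x ∈ Omega q D, Tendsto g (𝓝[{y | xq y ≠ 0}] x) (𝓝 (G (sqMap x))) := by
    intro G hG g hg x hx
    have hc : ContinuousAt (fun y => G (sqMap y)) x :=
      ContinuousAt.comp (g := G) (hG _ (sqMap_mem hq hx)).continuousAt continuous_sqMap.continuousAt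
    refine (hc.tendsto.mono_left nhdsWithin_le_nhds).congr' ?_
    filter_upwards [self_mem_nhdsWithin,
      nhdsWithin_le_nhds ((isOpen_Omega hq hD).mem_nhds hx)] with y hy hyΩ
    exact (hg y hyΩ hy).symm
  refine ⟨G₁, G₂, hG₁, hG₂, fun x hx => ?_, fun x hx => ?_⟩
  · by_cases hx0 : xq x = 0
    · have := neBot_nhdsWithin_xq_ne_zero hq hx0
      have hxD := (mem_Omega_iff hq).1 hx
      have hc : ContinuousAt (fun y : Space p q => F₁ (xp y, ‖xq y‖)) x :=
        ContinuousAt.comp (g := F₁) (hF₁.continuousOn.continuousAt (hD.mem_nhds hxD))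
          (continuous_xp.prodMk continuous_xq.norm).continuousAt
      -- `G₁` is tied to `F₁` only for `s > 0`. On `ℝ^{p+1}` the equality comes from continuity of
      -- both sides.
      have hc' : Tendsto (sphValue f) (𝓝[{y | xq y ≠ 0}] x) (𝓝 (sphValue f x)) := by
        rw [h.sphValue_eq hx]
        refine (hc.tendsto.mono_left nhdsWithin_le_nhds).congr' ?_
        filter_upwards [nhdsWithin_le_nhds ((isOpen_Omega hq hD).mem_nhds hx)] with y hy
        exact (h.sphValue_eq hy).symm
      exact tendsto_nhds_unique hc' (hlim hG₁ hv x hx)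
    · exact hv x hx hx0
  · by_cases hx0 : xq x = 0
    · have := neBot_nhdsWithin_xq_ne_zero hq hx0
      rw [sphDeriv, if_pos hx0]
      exact (hlim hG₂ hd x hx).limUnder_eq
    · rw [sphDeriv, if_neg hx0]
      exact hd x hx hx0

end Geometry

/-! ### Differential equations in the variables `(y, s)` with `s = r²` -/

section Equations
variable {p q : ℕ} {W : Type*} [NormedAddCommGroup W] [NormedSpace ℝ W]

/-- The partial derivative in the `i`-th of the variables `x₀, …, x_p`. -/
def dX (i : Fin (p + 1)) (G : HalfSpace p → W) (z : HalfSpace p) : W :=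
  fderiv ℝ G z (EuclideanSpace.single i 1, 0)

/-- The partial derivative in the last variable. -/
def dS (G : HalfSpace p → W) (z : HalfSpace p) : W := fderiv ℝ G z (0, 1)

variable {G H : HalfSpace p → W} {z : HalfSpace p}

theorem dX_congr (h : G =ᶠ[𝓝 z] H) (i : Fin (p + 1)) : dX i G z = dX i H z := by
  rw [dX, h.fderiv_eq, dX]

theorem dS_congr (h : G =ᶠ[𝓝 z] H) : dS G z = dS H z := by
  rw [dS, h.fderiv_eq, dS]

section
variable [CompleteSpace W]

theorem _root_.AnalyticAt.dX (hG : AnalyticAt ℝ G z) (i : Fin (p + 1)) :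
    AnalyticAt ℝ (dX i G) z :=
  ((ContinuousLinearMap.apply ℝ W _).analyticAt _).fun_comp hG.fderiv

theorem _root_.AnalyticAt.dS (hG : AnalyticAt ℝ G z) : AnalyticAt ℝ (dS G) z :=
  ((ContinuousLinearMap.apply ℝ W _).analyticAt _).fun_comp hG.fderiv

theorem dX_dX_comm (hG : AnalyticAt ℝ G z) (i j : Fin (p + 1)) :
    dX i (dX j G) z = dX j (dX i G) z :=
  fderiv_fderiv_apply_comm hG.contDiffAt _ _

theorem dX_dS_comm (hG : AnalyticAt ℝ G z) (i : Fin (p + 1)) :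
    dX i (dS G) z = dS (dX i G) z :=
  fderiv_fderiv_apply_comm hG.contDiffAt _ _

end

theorem dX_clm_sum {α : Type*} (s : Finset α) (A : α → W →L[ℝ] W) {K : α → HalfSpace p → W}
    (hK : ∀ j, DifferentiableAt ℝ (K j) z) (i : Fin (p + 1)) :
    dX i (fun w => ∑ j ∈ s, A j (K j w)) z = ∑ j ∈ s, A j (dX i (K j) z) := by
  have h : HasFDerivAt (fun w => ∑ j ∈ s, A j (K j w)) (∑ j ∈ s, (A j).comp (fderiv ℝ (K j) z)) z :=
    HasFDerivAt.fun_sum fun j _ => (A j).hasFDerivAt.comp z (hK j).hasFDerivAt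
  rw [dX, h.fderiv]
  simp [dX]

theorem dS_clm_sum {α : Type*} (s : Finset α) (A : α → W →L[ℝ] W) {K : α → HalfSpace p → W}
    (hK : ∀ j, DifferentiableAt ℝ (K j) z) :
    dS (fun w => ∑ j ∈ s, A j (K j w)) z = ∑ j ∈ s, A j (dS (K j) z) := by
  have h : HasFDerivAt (fun w => ∑ j ∈ s, A j (K j w)) (∑ j ∈ s, (A j).comp (fderiv ℝ (K j) z)) z :=
    HasFDerivAt.fun_sum fun j _ => (A j).hasFDerivAt.comp z (hK j).hasFDerivAt
  rw [dS, h.fderiv]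
  simp [dS]

theorem dX_add (hG : DifferentiableAt ℝ G z) (hH : DifferentiableAt ℝ H z) (i : Fin (p + 1)) :
    dX i (fun w => G w + H w) z = dX i G z + dX i H z := by
  simp [dX, fderiv_fun_add hG hH]

theorem dS_add (hG : DifferentiableAt ℝ G z) (hH : DifferentiableAt ℝ H z) :
    dS (fun w => G w + H w) z = dS G z + dS H z := by
  simp [dS, fderiv_fun_add hG hH]

theorem dX_const_smul (hG : DifferentiableAt ℝ G z) (c : ℝ) (i : Fin (p + 1)) :
    dX i (fun w => c • G w) z = c • dX i G z := by
  simp [dX, fderiv_fun_const_smul hG]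

theorem dS_const_smul (hG : DifferentiableAt ℝ G z) (c : ℝ) :
    dS (fun w => c • G w) z = c • dS G z := by
  simp [dS, fderiv_fun_const_smul hG]

theorem dX_snd_smul (hG : DifferentiableAt ℝ G z) (c : ℝ) (i : Fin (p + 1)) :
    dX i (fun w => (c * w.2) • G w) z = (c * z.2) • dX i G z := by
  have h : HasFDerivAt (fun w : HalfSpace p => c * w.2) (c • ContinuousLinearMap.snd ℝ _ ℝ) z :=
    hasFDerivAt_snd.const_mul c
  rw [dX, (h.fun_smul hG.hasFDerivAt).fderiv]
  simp [dX]

theorem dS_snd_smul (hG : DifferentiableAt ℝ G z) (c : ℝ) :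
    dS (fun w => (c * w.2) • G w) z = c • G z + (c * z.2) • dS G z := by
  have h : HasFDerivAt (fun w : HalfSpace p => c * w.2) (c • ContinuousLinearMap.snd ℝ _ ℝ) z :=
    hasFDerivAt_snd.const_mul c
  rw [dS, (h.fun_smul hG.hasFDerivAt).fderiv]
  simp [dS, add_comm]

theorem hasFDerivAt_sqMap (x : Space p q) :
    HasFDerivAt (sqMap : Space p q → HalfSpace p)
      ((xpL p q).prod (2 • (innerSL ℝ (xq x)).comp (xqL p q))) x :=
  (xpL p q).hasFDerivAt.prodMk (xqL p q).hasFDerivAt.norm_sq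

theorem fderiv_comp_sqMap {x : Space p q} (hG : DifferentiableAt ℝ G (sqMap x)) (v : Space p q) :
    fderiv ℝ (fun y => G (sqMap y)) x v =
      fderiv ℝ G (sqMap x) (xp v, 2 * inner ℝ (xq x) (xq v)) := by
  have h : HasFDerivAt (fun y => G (sqMap y)) _ x := hG.hasFDerivAt.comp x (hasFDerivAt_sqMap x)
  rw [h.fderiv]
  simp [xpL_apply, xqL_apply, two_mul]

theorem xp_single_inl (i : Fin (p + 1)) :
    xp (EuclideanSpace.single (Sum.inl i) 1 : Space p q) = EuclideanSpace.single i 1 := by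
  ext j
  by_cases h : j = i <;> simp [xp, h]

theorem xq_single_inl (i : Fin (p + 1)) :
    xq (EuclideanSpace.single (Sum.inl i) 1 : Space p q) = 0 := by
  ext j
  simp [xq]

theorem xp_single_inr (j : Fin q) :
    xp (EuclideanSpace.single (Sum.inr j) 1 : Space p q) = 0 := by
  ext i
  simp [xp]

theorem xq_single_inr (j : Fin q) :
    xq (EuclideanSpace.single (Sum.inr j) 1 : Space p q) = EuclideanSpace.single j 1 := by
  ext i
  by_cases h : i = j <;> simp [xq, h]

theorem fderiv_comp_sqMap_inl {x : Space p q} (hG : DifferentiableAt ℝ G (sqMap x))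
    (i : Fin (p + 1)) :
    fderiv ℝ (fun y => G (sqMap y)) x (EuclideanSpace.single (Sum.inl i) 1) =
      dX i G (sqMap x) := by
  rw [fderiv_comp_sqMap hG, xp_single_inl, xq_single_inl, inner_zero_right, mul_zero, dX]

theorem fderiv_comp_sqMap_inr {x : Space p q} (hG : DifferentiableAt ℝ G (sqMap x)) (j : Fin q) :
    fderiv ℝ (fun y => G (sqMap y)) x (EuclideanSpace.single (Sum.inr j) 1) =
      (2 * xq x j) • dS G (sqMap x) := by
  rw [fderiv_comp_sqMap hG, xp_single_inr, xq_single_inr, EuclideanSpace.inner_single_right, dS,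
    ← map_smul]
  simp

variable [CompleteSpace W]

theorem _root_.AnalyticAt.iterate_dS (hG : AnalyticAt ℝ G z) (k : ℕ) :
    AnalyticAt ℝ (dS^[k] G) z := by
  induction k with
  | zero => exact hG
  | succ k ih =>
    rw [Function.iterate_succ_apply']
    exact ih.dS

/-- The Darboux-type equation `∑ ∂ᵢ² G + 4 s ∂ₛ² G + c ∂ₛ G = 0` at the point `z = (y, s)`. -/
def SatisfiesDarboux (c : ℝ) (G : HalfSpace p → W) (z : HalfSpace p) : Prop :=
  ∑ i, dX i (dX i G) z + (4 * z.2) • dS (dS G) z + c • dS G z = 0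

/-- Differentiating the coefficient in `4s ∂ₛ²G` yields an extra `4 ∂ₛ(∂ₛG)`, which is the shift of
`c`. -/
theorem SatisfiesDarboux.deriv_last {c : ℝ} (hG : AnalyticAt ℝ G z)
    (h : ∀ᶠ w in 𝓝 z, SatisfiesDarboux c G w) : SatisfiesDarboux (c + 4) (dS G) z := by
  have hX : ∀ i, AnalyticAt ℝ (dX i (dX i G)) z := fun i => (hG.dX i).dX i
  have d : ∀ {K : HalfSpace p → W}, AnalyticAt ℝ K z → DifferentiableAt ℝ K z :=
    fun hK => hK.differentiableAt
  have h0 : dS (fun w => ∑ i, dX i (dX i G) w + (4 * w.2) • dS (dS G) w +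
      c • dS G w) z = 0 := by
    rw [dS_congr (H := fun _ => 0) h]
    simp [dS]
  have hs2 : AnalyticAt ℝ (fun w : HalfSpace p => (4 * w.2)) z :=
    analyticAt_const.fun_mul analyticAt_snd
  have hsum : AnalyticAt ℝ (fun w => ∑ i, dX i (dX i G) w) z :=
    Finset.univ.analyticAt_fun_sum fun i _ => hX i
  rw [dS_add (d (hsum.fun_add (hs2.fun_smul hG.dS.dS))) (d (analyticAt_const.fun_smul hG.dS)),
    dS_add (d hsum) (d (hs2.fun_smul hG.dS.dS)), dS_snd_smul (d hG.dS.dS),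
    dS_const_smul (d hG.dS)] at h0
  have h1 := dS_clm_sum (z := z) Finset.univ (fun _ => ContinuousLinearMap.id ℝ W)
    (K := fun i => dX i (dX i G)) fun i => d (hX i)
  simp only [ContinuousLinearMap.id_apply] at h1
  have h2 : ∀ i, dX i (dX i (dS G)) z = dS (dX i (dX i G)) z := by
    intro i
    rw [← dX_dS_comm (hG.dX i)]
    refine dX_congr ?_ i
    filter_upwards [hG.eventually_analyticAt] with w hw
    exact dX_dS_comm hw i
  rw [SatisfiesDarboux]
  simp_rw [h2]
  rw [← h1, ← h0]
  module

/-- A first-order system of Cauchy-Riemann type implies the Darboux-type equations. -/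
theorem satisfiesDarboux_of_system {A B : Fin (p + 1) → W →L[ℝ] W}
    (hAB : ∀ i j w, B i (A j w) + B j (A i w) = if i = j then (2 : ℝ) • w else 0)
    (hBA : ∀ i j w, A i (B j w) + A j (B i w) = if i = j then (2 : ℝ) • w else 0)
    (hG : AnalyticAt ℝ G z) (hH : AnalyticAt ℝ H z)
    (h1 : ∀ᶠ w in 𝓝 z, ∑ i, A i (dX i G w) = H w + (2 * w.2) • dS H w)
    (h2 : ∀ᶠ w in 𝓝 z, ∑ i, B i (dX i H w) = (-2 : ℝ) • dS G w) :
    SatisfiesDarboux 2 G z ∧ SatisfiesDarboux 6 H z := by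
  have d : ∀ {K : HalfSpace p → W}, AnalyticAt ℝ K z → DifferentiableAt ℝ K z :=
    fun hK => hK.differentiableAt
  have hs2 : AnalyticAt ℝ (fun w : HalfSpace p => (2 * w.2)) z :=
    analyticAt_const.fun_mul analyticAt_snd
  have hBS : ∑ i, B i (dX i (dS H) z) = (-2 : ℝ) • dS (dS G) z := by
    simp_rw [dX_dS_comm hH]
    rw [← dS_clm_sum _ B fun i => d (hH.dX i), dS_congr h2, dS_const_smul (d hG.dS)]
  -- The `3` is `1 + 2`: `∂ₛ` of `H` and of the factor `2s`. It becomes the constant `6` after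
  -- multiplication by `2`.
  have hAS : ∑ i, A i (dX i (dS G) z) = (3 : ℝ) • dS H z + (2 * z.2) • dS (dS H) z := by
    simp_rw [dX_dS_comm hG]
    rw [← dS_clm_sum _ A fun i => d (hG.dX i), dS_congr h1, dS_add (d hH) (d (hs2.fun_smul hH.dS)),
      dS_snd_smul (d hH.dS)]
    module
  constructor
  · have h3 : ∀ j, ∑ i, A i (dX j (dX i G) z) = dX j H z + (2 * z.2) • dX j (dS H) z := fun j => by
      rw [← dX_clm_sum _ A (fun i => d (hG.dX i)), dX_congr h1,
        dX_add (d hH) (d (hs2.fun_smul hH.dS)), dX_snd_smul (d hH.dS)]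
    have h4 := clifford_sum_symm hAB (X := fun j i => dX j (dX i G) z) fun i j => dX_dX_comm hG i j
    simp_rw [h3, map_add, Finset.sum_add_distrib, map_smul, ← Finset.smul_sum] at h4
    rw [h2.self_of_nhds, hBS] at h4
    rw [SatisfiesDarboux, ← h4]
    module
  · have h3 : ∀ j, ∑ i, B i (dX j (dX i H) z) = (-2 : ℝ) • dX j (dS G) z := fun j => by
      rw [← dX_clm_sum _ B (fun i => d (hH.dX i)), dX_congr h2, dX_const_smul (d hG.dS)]
    have h4 := clifford_sum_symm hBA (X := fun j i => dX j (dX i H) z) fun i j => dX_dX_comm hH i j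
    simp_rw [h3, map_smul, ← Finset.smul_sum] at h4
    rw [hAS] at h4
    rw [SatisfiesDarboux, ← h4]
    module

/-! ### The Laplacian of a function of `(x_p, |x_q|²)` -/

/-- By the chain rule `∂ⱼ` in a variable of `x_q` is `2xⱼ ∂ₛ`, hence `∂ⱼ²` is `4xⱼ² ∂ₛ² + 2∂ₛ`;
summing over the `q` variables gives the last two terms. -/
theorem lap_comp_sqMap {G : HalfSpace p → Cl (p + q)} {x : Space p q}
    (hG : AnalyticAt ℝ G (sqMap x)) :
    lap (fun y => G (sqMap y)) x = ∑ i, dX i (dX i G) (sqMap x) +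
      (4 * ‖xq x‖ ^ 2) • dS (dS G) (sqMap x) + (2 * q : ℝ) • dS G (sqMap x) := by
  have : CompleteSpace (Cl (p + q)) := FiniteDimensional.complete ℝ _
  have hτ : ContDiff ℝ 2 (sqMap : Space p q → HalfSpace p) :=
    (xpL p q).contDiff.prodMk ((xqL p q).contDiff.norm_sq ℝ)
  have hcd : ContDiffAt ℝ 2 (fun y => G (sqMap y)) x :=
    ContDiffAt.comp (g := G) x hG.contDiffAt hτ.contDiffAt
  have hev : ∀ᶠ y in 𝓝 x, AnalyticAt ℝ G (sqMap y) :=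
    continuous_sqMap.continuousAt.eventually hG.eventually_analyticAt
  have hl : ∀ i, fderiv ℝ (fun y => fderiv ℝ (fun y => G (sqMap y)) y
      (EuclideanSpace.single (Sum.inl i) 1)) x (EuclideanSpace.single (Sum.inl i) 1) =
      dX i (dX i G) (sqMap x) := by
    intro i
    rw [← fderiv_comp_sqMap_inl (hG.dX i).differentiableAt]
    congr 1
    refine Filter.EventuallyEq.fderiv_eq ?_
    filter_upwards [hev] with y hy using fderiv_comp_sqMap_inl hy.differentiableAt i
  have hr : ∀ j, fderiv ℝ (fun y => fderiv ℝ (fun y => G (sqMap y)) y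
      (EuclideanSpace.single (Sum.inr j) 1)) x (EuclideanSpace.single (Sum.inr j) 1) =
      (4 * xq x j ^ 2) • dS (dS G) (sqMap x) + (2 : ℝ) • dS G (sqMap x) := by
    intro j
    have e : (fun y => fderiv ℝ (fun y => G (sqMap y)) y (EuclideanSpace.single (Sum.inr j) 1))
        =ᶠ[𝓝 x] fun y : Space p q => (2 * xq y j) • dS G (sqMap y) := by
      filter_upwards [hev] with y hy using fderiv_comp_sqMap_inr hy.differentiableAt j
    have hc : HasFDerivAt (fun y : Space p q => 2 * xq y j)
        ((2 : ℝ) • (EuclideanSpace.proj (Sum.inr j) : Space p q →L[ℝ] ℝ)) x :=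
      ((EuclideanSpace.proj (Sum.inr j) : Space p q →L[ℝ] ℝ).hasFDerivAt).const_mul 2
    have hS : DifferentiableAt ℝ (fun y => dS G (sqMap y)) x :=
      DifferentiableAt.comp (g := dS G) x hG.dS.differentiableAt
        (hasFDerivAt_sqMap x).differentiableAt
    rw [e.fderiv_eq, (hc.fun_smul hS.hasFDerivAt).fderiv]
    simp only [add_apply, smul_apply, ContinuousLinearMap.smulRight_apply,
      fderiv_comp_sqMap_inr hG.dS.differentiableAt]
    simp
    module
  have hn : ∑ j, xq x j ^ 2 = ‖xq x‖ ^ 2 := by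
    rw [EuclideanSpace.norm_sq_eq]; simp
  rw [lap, InnerProductSpace.laplacian_eq_iteratedFDeriv_orthonormalBasis _
    (EuclideanSpace.basisFun (Fin (p + 1) ⊕ Fin q) ℝ)]
  simp only [iteratedFDeriv_two_apply, Matrix.cons_val_zero, Matrix.cons_val_one,
    EuclideanSpace.basisFun_apply, ← fderiv_fderiv_apply hcd]
  rw [Fintype.sum_sum_type]
  simp_rw [hl, hr, Finset.sum_add_distrib, ← Finset.sum_smul, ← Finset.mul_sum, hn]
  rw [Finset.sum_const, Finset.card_univ, Fintype.card_fin]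
  module

end Equations

/-! ### From the Cauchy-Riemann equations to iterated Laplacians -/

section Main
variable {p q : ℕ} {D : Set (HalfSpace p)} {f : Space p q → Cl (p + q)}

/-- The set of the points `(y, r²)` with `(y, r) ∈ D` and `r > 0`. -/
def sqInterior (D : Set (HalfSpace p)) : Set (HalfSpace p) := {z | 0 < z.2 ∧ (z.1, √z.2) ∈ D}

theorem isOpen_sqInterior (hD : IsOpen D) : IsOpen (sqInterior D) := by
  have h : Continuous fun z : HalfSpace p => (z.1, √z.2) := by fun_prop
  exact (isOpen_lt continuous_const continuous_snd).inter (hD.preimage h)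

theorem sqInterior_subset : sqInterior D ⊆ sqImage D := fun z hz =>
  ⟨(z.1, √z.2), hz.2, by simp [Real.sq_sqrt hz.1.le]⟩

theorem sqImage_subset_closure (hD : IsOpen D) (hsymm : ∀ y r, (y, r) ∈ D → (y, -r) ∈ D) :
    sqImage D ⊆ closure (sqInterior D) := by
  rintro _ ⟨⟨y, r⟩, hz, rfl⟩
  by_cases hr : r = 0
  · subst hr
    have h : Tendsto (fun t : ℝ => (y, t)) (𝓝[>] 0) (𝓝 (y, (0 : ℝ))) := by
      have : Continuous fun t : ℝ => (y, t) := by fun_prop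
      exact (this.tendsto 0).mono_left nhdsWithin_le_nhds
    simp only [zero_pow two_ne_zero]
    refine mem_closure_of_tendsto h ?_
    have hev := h.eventually ((tendsto_sqrt_snd y).eventually (hD.mem_nhds hz))
    filter_upwards [self_mem_nhdsWithin, hev] with t ht ht'
    exact ⟨ht, ht'⟩
  · refine subset_closure ⟨by positivity, ?_⟩
    simp only [Real.sqrt_sq_eq_abs]
    rcases abs_choice r with h | h <;> rw [h]
    exacts [hz, hsymm _ _ hz]

/-- An identity between continuous functions extends from `r > 0` to all of the image. -/
theorem eq_of_eqOn_sqInterior {W : Type*} [TopologicalSpace W] [T2Space W] (hD : IsOpen D)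
    (hsymm : ∀ y r, (y, r) ∈ D → (y, -r) ∈ D) {K L : HalfSpace p → W} {z : HalfSpace p}
    (hz : z ∈ sqImage D) (hK : ContinuousAt K z) (hL : ContinuousAt L z)
    (h : ∀ w ∈ sqInterior D, K w = L w) : K z = L z := by
  have hne : (𝓝[sqInterior D] z).NeBot :=
    mem_closure_iff_nhdsWithin_neBot.1 (sqImage_subset_closure hD hsymm hz)
  refine tendsto_nhds_unique (hK.tendsto.mono_left (nhdsWithin_le_nhds (s := sqInterior D)))
    ((hL.tendsto.mono_left nhdsWithin_le_nhds).congr' ?_)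
  filter_upwards [self_mem_nhdsWithin] with w hw using (h w hw).symm

theorem joinPt_mem_Omega {y : EuclideanSpace ℝ (Fin (p + 1))} {r : ℝ}
    {ω : EuclideanSpace ℝ (Fin q)} (hω : ‖ω‖ = 1) (hr : 0 ≤ r) (h : (y, r) ∈ D) :
    joinPt y (r • ω) ∈ Omega q D :=
  ⟨y, r, ω, hω, hr, h, rfl⟩

/-- The generalized Cauchy-Riemann equations in terms of the representing pair. -/
theorem IsRepresentedBy.system {G₁ G₂ F₁ F₂ : HalfSpace p → Cl (p + q)} (hq : 1 ≤ q)
    (hD : IsOpen D) (hG : IsRepresentedBy D f G₁ G₂) (hF : IsInducedBy D f F₁ F₂)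
    (hCR : ∀ z ∈ D, diracHalf F₁ z - derivR F₂ z = 0 ∧ diracConjHalf F₂ z + derivR F₁ z = 0)
    {z : HalfSpace p} (hz : z ∈ sqInterior D) :
    ∑ i, unit p q i * dX i G₁ z = G₂ z + (2 * z.2) • dS G₂ z ∧
      ∑ i, unitConj p q i * dX i G₂ z = (-2 : ℝ) • dS G₁ z := by
  obtain ⟨y, s⟩ := z
  obtain ⟨hs, hzD⟩ := hz
  obtain ⟨r, hr, rfl⟩ : ∃ r : ℝ, 0 < r ∧ r ^ 2 = s :=
    ⟨√s, Real.sqrt_pos.2 hs, Real.sq_sqrt (le_of_lt hs)⟩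
  simp only [Real.sqrt_sq hr.le] at hzD
  obtain ⟨ω, hω⟩ := exists_norm_eq_one hq
  have hpos : ∀ᶠ w : HalfSpace p in 𝓝 (y, r), 0 < w.2 :=
    continuousAt_snd.eventually (lt_mem_nhds hr)
  have e1 : F₁ =ᶠ[𝓝 (y, r)] fun w => G₁ (w.1, w.2 ^ 2) := by
    filter_upwards [hpos, hD.mem_nhds hzD] with w hw hwD
    have hx : joinPt w.1 (w.2 • ω) ∈ Omega q D := joinPt_mem_Omega hω hw.le hwD
    have := (hF.sphValue_eq hx).symm.trans (hG.value _ hx)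
    simpa [norm_smul, hω, abs_of_pos hw] using this
  -- For `r > 0` the spherical derivative is `r⁻¹ F₂`. Equality on a neighbourhood is needed to
  -- differentiate it.
  have e2 : F₂ =ᶠ[𝓝 (y, r)] fun w => w.2 • G₂ (w.1, w.2 ^ 2) := by
    filter_upwards [hpos, hD.mem_nhds hzD] with w hw hwD
    have hx : joinPt w.1 (w.2 • ω) ∈ Omega q D := joinPt_mem_Omega hω hw.le hwD
    have hω0 : ω ≠ 0 := norm_ne_zero_iff.1 (by rw [hω]; norm_num)
    have hx0 : xq (joinPt w.1 (w.2 • ω)) ≠ 0 := smul_ne_zero hw.ne' hω0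
    have hval := hG.deriv _ hx
    rw [sphDeriv, if_neg hx0, hF.sphDerivAux_eq hx hx0] at hval
    simp only [xp_joinPt, xq_joinPt, norm_smul, hω, mul_one, Real.norm_of_nonneg hw.le] at hval
    rw [← hval, smul_inv_smul₀ hw.ne']
  have hm : HasFDerivAt (fun w : HalfSpace p => (w.1, w.2 ^ 2))
      ((ContinuousLinearMap.fst ℝ _ ℝ).prod ((2 * r) • ContinuousLinearMap.snd ℝ _ ℝ)) (y, r) := by
    have h2 : HasFDerivAt (fun w : HalfSpace p => w.2 ^ 2) _ (y, r) :=
      (hasFDerivAt_snd (𝕜 := ℝ) (p := (y, r))).pow 2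
    exact (hasFDerivAt_fst.prodMk h2).congr_fderiv (by simp)
  have hmem : ((y, r ^ 2) : HalfSpace p) ∈ sqImage D := ⟨_, hzD, rfl⟩
  have d1 : HasFDerivAt (fun w : HalfSpace p => G₁ (w.1, w.2 ^ 2)) _ (y, r) :=
    HasFDerivAt.comp (y, r) (hG.analytic₁ _ hmem).differentiableAt.hasFDerivAt hm
  have d2 : HasFDerivAt (fun w : HalfSpace p => G₂ (w.1, w.2 ^ 2)) _ (y, r) :=
    HasFDerivAt.comp (y, r) (hG.analytic₂ _ hmem).differentiableAt.hasFDerivAt hm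
  have d2' : HasFDerivAt (fun w : HalfSpace p => w.2 • G₂ (w.1, w.2 ^ 2)) _ (y, r) :=
    hasFDerivAt_snd.fun_smul d2
  have hS : ∀ (G : HalfSpace p → Cl (p + q)) (c : ℝ),
      fderiv ℝ G (y, r ^ 2) (0, c) = c • dS G (y, r ^ 2) := fun G c => by
    rw [dS, ← map_smul]
    simp
  obtain ⟨c1, c2⟩ := hCR _ hzD
  rw [sub_eq_zero] at c1
  rw [add_eq_zero_iff_eq_neg] at c2
  simp only [diracHalf, diracConjHalf, derivR, e1.fderiv_eq, e2.fderiv_eq, d1.fderiv,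
    d2'.fderiv] at c1 c2
  simp only [add_apply, smul_apply, ContinuousLinearMap.comp_apply, ContinuousLinearMap.prod_apply,
    ContinuousLinearMap.coe_fst', ContinuousLinearMap.coe_snd', ContinuousLinearMap.smulRight_apply,
    mul_zero, zero_smul, add_zero, smul_eq_mul, mul_one, one_smul, hS] at c1 c2
  constructor
  · refine c1.trans ?_
    module
  · simp only [mul_smul_comm, ← Finset.smul_sum] at c2
    -- The chain rule gives `∂ᵣF₁ = 2r ∂ₛG₁`, and `F₂` carries a factor `r`; the common `r` cancels.
    have := congrArg (fun a => r⁻¹ • a) c2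
    simp only [inv_smul_smul₀ hr.ne'] at this
    refine this.trans ?_
    rw [smul_neg, smul_smul, mul_comm 2 r, inv_mul_cancel_left₀ hr.ne', neg_smul]

theorem partialLast_eq {G : HalfSpace p → Cl (p + q)} {k : ℕ} {z : HalfSpace p}
    (hG : AnalyticAt ℝ G z) : partialLast k G z = dS^[k] G z := by
  have : CompleteSpace (Cl (p + q)) := FiniteDimensional.complete ℝ _
  induction k generalizing z with
  | zero => simp [partialLast]
  | succ k ih =>
    have hd : DifferentiableAt ℝ (dS^[k] G) z := (hG.iterate_dS k).differentiableAt
    have hline : HasDerivAt (fun s : ℝ => (z.1, s)) ((0 : EuclideanSpace ℝ (Fin (p + 1))), (1 : ℝ))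
        z.2 := (hasDerivAt_const _ _).prodMk (hasDerivAt_id _)
    have hc : Tendsto (fun s : ℝ => (z.1, s)) (𝓝 z.2) (𝓝 z) := hline.continuousAt
    rw [partialLast, iteratedDeriv_succ, Function.iterate_succ_apply', dS]
    have e : iteratedDeriv k (fun s : ℝ => G (z.1, s)) =ᶠ[𝓝 z.2] fun s => dS^[k] G (z.1, s) := by
      filter_upwards [hc.eventually hG.eventually_analyticAt] with s hs
      exact ih hs
    rw [e.deriv_eq]
    exact (HasFDerivAt.comp_hasDerivAt z.2 (f := fun s : ℝ => (z.1, s)) hd.hasFDerivAt hline).deriv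

/-- The iterated Laplacian of a function of `(x_p, |x_q|²)` for a solution of a Darboux-type
equation. -/
theorem iterate_lap_eq (hq : 1 ≤ q) (hD : IsOpen D)
    (hsymm : ∀ y r, (y, r) ∈ D → (y, -r) ∈ D) {c : ℝ} {g : Space p q → Cl (p + q)}
    {G : HalfSpace p → Cl (p + q)} (hG : AnalyticOnNhd ℝ G (sqImage D))
    (hg : ∀ x ∈ Omega q D, g x = G (sqMap x))
    (hc : ∀ z ∈ sqInterior D, SatisfiesDarboux c G z) (k : ℕ) {x : Space p q}
    (hx : x ∈ Omega q D) :
    (lap^[k] g) x = (∏ j ∈ Finset.Icc 1 k, (2 * q - c - 4 * (j - 1) : ℝ)) • dS^[k] G (sqMap x) := by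
  have : CompleteSpace (Cl (p + q)) := FiniteDimensional.complete ℝ _
  -- Differentiating the equation requires it on a neighbourhood, hence the open set `s > 0`; points
  -- with `s = 0` are reached afterwards by continuity.
  have hck : ∀ k : ℕ, ∀ z ∈ sqInterior D, SatisfiesDarboux (c + 4 * k) (dS^[k] G) z := by
    intro k
    induction k with
    | zero => simpa using hc
    | succ k ih =>
      intro z hz
      rw [Function.iterate_succ_apply']
      have := SatisfiesDarboux.deriv_last ((hG _ (sqInterior_subset hz)).iterate_dS k)
        (eventually_of_mem ((isOpen_sqInterior hD).mem_nhds hz) ih)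
      convert this using 1
      push_cast
      ring
  induction k generalizing x with
  | zero => simpa using hg x hx
  | succ k ih =>
    set C := ∏ j ∈ Finset.Icc 1 k, (2 * q - c - 4 * (j - 1) : ℝ) with hC
    set K := dS^[k] G with hK
    have hKa : AnalyticOnNhd ℝ K (sqImage D) := fun z hz => (hG z hz).iterate_dS k
    have e : lap^[k] g =ᶠ[𝓝 x] fun y => C • K (sqMap y) := by
      filter_upwards [(isOpen_Omega hq hD).mem_nhds hx] with y hy using ih hy
    have hz := sqMap_mem hq hx
    have hKx := hKa _ hz
    have hcd : ContDiffAt ℝ 2 (fun y => K (sqMap y)) x :=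
      ContDiffAt.comp (g := K) x hKx.contDiffAt
        ((xpL p q).contDiff.prodMk ((xqL p q).contDiff.norm_sq ℝ)).contDiffAt
    have hpde : SatisfiesDarboux (c + 4 * k) K (sqMap x) := by
      have hX : ContinuousAt (fun z => ∑ i, dX i (dX i K) z) (sqMap x) :=
        (Finset.univ.analyticAt_fun_sum fun i _ => (hKx.dX i).dX i).continuousAt
      have hSS : ContinuousAt (dS (dS K)) (sqMap x) := hKx.dS.dS.continuousAt
      have hS : ContinuousAt (dS K) (sqMap x) := hKx.dS.continuousAt
      exact eq_of_eqOn_sqInterior hD hsymm hz (L := fun _ => 0)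
        (K := fun z => ∑ i, dX i (dX i K) z + (4 * z.2) • dS (dS K) z + (c + 4 * k) • dS K z)
        (by fun_prop) continuousAt_const (hck k)
    rw [Function.iterate_succ_apply', Function.iterate_succ_apply']
    have h1 : lap (lap^[k] g) x = lap (fun y => C • K (sqMap y)) x :=
      (InnerProductSpace.laplacian_congr_nhds e).self_of_nhds
    have h2 : lap (fun y => C • K (sqMap y)) x = C • lap (fun y => K (sqMap y)) x :=
      InnerProductSpace.laplacian_smul C hcd
    rw [h1, h2, lap_comp_sqMap hKx, Finset.prod_Icc_succ_top (by omega), ← hC, mul_smul C]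
    congr 1
    rw [SatisfiesDarboux] at hpde
    have h3 : ∑ i, dX i (dX i K) (sqMap x) =
        -- Subtracting the equation from the Laplacian leaves `(2q - c - 4k) ∂ₛK`, the factor with
        -- index `j = k + 1`.
        -((4 * (sqMap x).2) • dS (dS K) (sqMap x) + (c + 4 * k) • dS K (sqMap x)) := by
      rw [eq_neg_iff_add_eq_zero, ← add_assoc, hpde]
    rw [h3]
    simp only [sqMap]
    push_cast
    module

end Main
end PartialSlice

end

/-! ### Assembly of the five statements -/

theorem theorem3p2 (p q : ℕ) (hq : 1 ≤ q)
    (D : Set (PartialSlice.HalfSpace p)) (hD : IsOpen D)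
    (hsymm : ∀ (y : EuclideanSpace ℝ (Fin (p + 1))) (r : ℝ), (y, r) ∈ D → (y, -r) ∈ D)
    (f : PartialSlice.Space p q → PartialSlice.Cl (p + q))
    (hf : PartialSlice.IsRegular D f) :
    (∃ G₁ G₂ : PartialSlice.HalfSpace p → PartialSlice.Cl (p + q),
      PartialSlice.IsRepresentedBy D f G₁ G₂) ∧
    (∀ G₁ G₂ : PartialSlice.HalfSpace p → PartialSlice.Cl (p + q),
      PartialSlice.IsRepresentedBy D f G₁ G₂ →
      (∀ k : ℕ, 1 ≤ k → k ≤ (q - 1) / 2 → ∀ x ∈ PartialSlice.Omega q D,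
        (PartialSlice.lap^[k] (PartialSlice.sphDeriv f)) x =
          (2 ^ k * ∏ j ∈ Finset.Icc 1 k, ((q : ℝ) - 2 * j - 1)) •
            PartialSlice.partialLast k G₂ (PartialSlice.xp x, ‖PartialSlice.xq x‖ ^ 2)) ∧
      (∀ k : ℕ, 1 ≤ k → k ≤ (q + 1) / 2 → ∀ x ∈ PartialSlice.Omega q D,
        (PartialSlice.lap^[k] (PartialSlice.sphValue f)) x =
          (2 ^ k * ∏ j ∈ Finset.Icc 1 k, ((q : ℝ) - 2 * j + 1)) •
            PartialSlice.partialLast k G₁ (PartialSlice.xp x, ‖PartialSlice.xq x‖ ^ 2))) ∧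
    (∀ x ∈ PartialSlice.Omega q D, PartialSlice.xq x ≠ 0 →
      PartialSlice.lap (PartialSlice.sphDeriv f) x =
        (((q : ℝ) - 3) / ‖PartialSlice.xq x‖ ^ 2) •
          (PartialSlice.dirac (PartialSlice.sphValue f) x - PartialSlice.sphDeriv f x)) ∧
    (∀ x ∈ PartialSlice.Omega q D,
      PartialSlice.lap (PartialSlice.sphValue f) x =
        (1 - (q : ℝ)) • PartialSlice.diracConj (PartialSlice.sphDeriv f) x) ∧
    (Odd q → ∀ x ∈ PartialSlice.Omega q D,
      (PartialSlice.lap^[(q + 1) / 2] (PartialSlice.sphValue f)) x = 0) := by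
  open PartialSlice Topology Filter in
  have : CompleteSpace (Cl (p + q)) := FiniteDimensional.complete ℝ _
  obtain ⟨G₁, G₂, hG⟩ := hf.exists_isRepresentedBy hq hD hsymm
  obtain ⟨F₁, F₂, hF, -, -, hCR⟩ := hf
  have hUC : ∀ (i j : Fin (p + 1)) (w : Cl (p + q)),
      lmul (unitConj p q i) (lmul (unit p q j) w) + lmul (unitConj p q j) (lmul (unit p q i) w) =
        if i = j then (2 : ℝ) • w else 0 := fun i j w => by
    simp only [lmul_apply, ← mul_assoc, ← add_mul, unitConj_mul_unit_add]
    split_ifs <;> simp [two_mul, two_smul]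
  have hCU : ∀ (i j : Fin (p + 1)) (w : Cl (p + q)),
      lmul (unit p q i) (lmul (unitConj p q j) w) + lmul (unit p q j) (lmul (unitConj p q i) w) =
        if i = j then (2 : ℝ) • w else 0 := fun i j w => by
    simp only [lmul_apply, ← mul_assoc, ← add_mul, unit_mul_unitConj_add]
    split_ifs <;> simp [two_mul, two_smul]
  -- The factors `2q - c - 4(j - 1)` are `2(q - 2j - 1)` for `c = 6` and `2(q - 2j + 1)` for `c =
  -- 2`.
  have hmain : ∀ G₁ G₂ : HalfSpace p → Cl (p + q), IsRepresentedBy D f G₁ G₂ →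
      (∀ k : ℕ, ∀ x ∈ Omega q D, (lap^[k] (sphDeriv f)) x =
          (2 ^ k * ∏ j ∈ Finset.Icc 1 k, ((q : ℝ) - 2 * j - 1)) • dS^[k] G₂ (sqMap x)) ∧
      (∀ k : ℕ, ∀ x ∈ Omega q D, (lap^[k] (sphValue f)) x =
          (2 ^ k * ∏ j ∈ Finset.Icc 1 k, ((q : ℝ) - 2 * j + 1)) • dS^[k] G₁ (sqMap x)) := by
    intro G₁ G₂ hG
    have hdar : ∀ z ∈ sqInterior D, SatisfiesDarboux 2 G₁ z ∧ SatisfiesDarboux 6 G₂ z := by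
      intro z hz
      have hz' := sqInterior_subset hz
      have hev := eventually_of_mem ((isOpen_sqInterior hD).mem_nhds hz) fun w hw =>
        hG.system hq hD hF hCR hw
      exact satisfiesDarboux_of_system hUC hCU (hG.analytic₁ z hz') (hG.analytic₂ z hz')
        (hev.mono fun w hw => hw.1) (hev.mono fun w hw => hw.2)
    have hprod : ∀ (k : ℕ) (a : ℕ → ℝ), 2 ^ k * ∏ j ∈ Finset.Icc 1 k, a j =
        ∏ j ∈ Finset.Icc 1 k, (2 * a j) := fun k a => by
      rw [Finset.prod_mul_distrib, Finset.prod_const, Nat.card_Icc, Nat.add_sub_cancel]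
    refine ⟨fun k x hx => ?_, fun k x hx => ?_⟩
    · rw [iterate_lap_eq hq hD hsymm hG.analytic₂ hG.deriv (fun z hz => (hdar z hz).2) k hx, hprod]
      congr 1
      exact Finset.prod_congr rfl fun j _ => by ring
    · rw [iterate_lap_eq hq hD hsymm hG.analytic₁ hG.value (fun z hz => (hdar z hz).1) k hx, hprod]
      congr 1
      exact Finset.prod_congr rfl fun j _ => by ring
  have heq : ∀ {g : Space p q → Cl (p + q)} {G : HalfSpace p → Cl (p + q)},
      (∀ x ∈ Omega q D, g x = G (sqMap x)) → ∀ x ∈ Omega q D,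
        g =ᶠ[𝓝 x] fun y => G (sqMap y) := fun h x hx =>
    eventually_of_mem ((isOpen_Omega hq hD).mem_nhds hx) h
  refine ⟨⟨G₁, G₂, hG⟩, fun G₁ G₂ hG => ⟨fun k _ _ x hx => ?_, fun k _ _ x hx => ?_⟩,
    fun x hx hx0 => ?_, fun x hx => ?_, fun hodd x hx => ?_⟩
  · rw [(hmain G₁ G₂ hG).1 k x hx, ← partialLast_eq (hG.analytic₂ _ (sqMap_mem hq hx))]
    rfl
  · rw [(hmain G₁ G₂ hG).2 k x hx, ← partialLast_eq (hG.analytic₁ _ (sqMap_mem hq hx))]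
    rfl
  · have hmem : sqMap x ∈ sqInterior D := by
      have hpos : 0 < ‖xq x‖ := norm_pos_iff.2 hx0
      refine ⟨by simp only [sqMap]; positivity, ?_⟩
      simpa [sqMap] using (mem_Omega_iff hq).1 hx
    have hn : ‖xq x‖ ^ 2 ≠ 0 := pow_ne_zero 2 (norm_ne_zero_iff.2 hx0)
    have h1 := (hmain G₁ G₂ hG).1 1 x hx
    have h2 : dirac (sphValue f) x = ∑ i, unit p q i * dX i G₁ (sqMap x) := by
      rw [dirac, (heq hG.value x hx).fderiv_eq]
      simp_rw [fderiv_comp_sqMap_inl (hG.analytic₁ _ (sqMap_mem hq hx)).differentiableAt]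
    -- The first equation of the system gives `D f°ₛ - f'ₛ = 2r² ∂ₛG₂`, to be compared with `Δf'ₛ =
    -- 2(q - 3) ∂ₛG₂`.
    rw [h2, (hG.system hq hD hF hCR hmem).1, hG.deriv x hx]
    change _ = _ • (G₂ (sqMap x) + _ - G₂ (sqMap x))
    rw [add_sub_cancel_left, smul_smul]
    simp only [Function.iterate_one] at h1
    rw [h1]
    congr 1
    simp only [sqMap]
    rw [Finset.Icc_self, Finset.prod_singleton]
    field_simp
    push_cast
    ring
  · have hz := sqMap_mem hq hx
    have h1 := (hmain G₁ G₂ hG).2 1 x hx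
    have h2 : diracConj (sphDeriv f) x = ∑ i, lmul (unitConj p q i) (dX i G₂ (sqMap x)) := by
      rw [diracConj, (heq hG.deriv x hx).fderiv_eq]
      simp_rw [fderiv_comp_sqMap_inl (hG.analytic₂ _ hz).differentiableAt, lmul_apply]
    -- The second equation of the system has no singular coefficient and passes to `s = 0` by
    -- continuity, which covers `ℝ^{p+1}`.
    have h3 : ∑ i, lmul (unitConj p q i) (dX i G₂ (sqMap x)) = (-2 : ℝ) • dS G₁ (sqMap x) := by
      refine eq_of_eqOn_sqInterior hD hsymm hz
        (K := fun z => ∑ i, lmul (unitConj p q i) (dX i G₂ z)) (L := fun z => (-2 : ℝ) • dS G₁ z)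
        ?_ ?_ fun w hw => (hG.system hq hD hF hCR hw).2
      · exact (Finset.univ.analyticAt_fun_sum fun i _ =>
          ((lmul (unitConj p q i)).analyticAt _).fun_comp
            ((hG.analytic₂ _ hz).dX i)).continuousAt
      · exact (hG.analytic₁ _ hz).dS.continuousAt.fun_const_smul (-2 : ℝ)
    rw [h2, h3, smul_smul]
    simp only [Function.iterate_one] at h1
    rw [h1]
    congr 1
    rw [Finset.Icc_self, Finset.prod_singleton]
    push_cast
    ring
  · obtain ⟨m, rfl⟩ := hodd
    -- With `q = 2m + 1` the last factor, `j = m + 1 = (q + 1)/2`, is `q - 2j + 1 = 0`.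
    rw [(hmain G₁ G₂ hG).2 _ x hx, Finset.prod_eq_zero (i := m + 1), mul_zero, zero_smul]
    · rw [Finset.mem_Icc]
      omega
    · push_cast
      ring
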